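/- A \emph{Wordle instance} $\mathrm{WI}=(\Sigma,d,D,W,g)$ consists of a finite alphabet $\Sigma$, a dimension $d\ge 1$, a dictionary $D\subseteq\Sigma^d$, a word list $W\subseteq D$ and a game length $g\ge 1$. For a target $w\in W$ and a query $u\in D$, the response $r=\Omega_w(u)\in\{0,1,2\}^d$ is given by $r_i=2$ if $w_i=u_i$; otherwise $r_i=1$ if $|\{j\le i : u_j=u_i,\ u_j\ne w_j\}|\le|\{j : w_j=u_i,\ w_j\ne u_j\}|$; and $r_i=0$ otherwise. A \emph{strategy} assigns to every finite sequence of queries and responses $u^1,r^1,\dots,u^{k-1},r^{k-1}$ a next query $u^k\in D$; it is \emph{winning} if, for every $w\in W$, when all responses are given by $\Omega_w$, some query $u^k$ with $k\le g$ receives the response $22\cdots2$. Let $|\mathrm{WI}|$ be the length of a description of $\mathrm{WI}$ as a string over a fixed finite alphabet, in which $|\Sigma|$, $d$ and $g$ are written in binary and the words of $D$ and of $W$ are listed letter by letter, each letter being written as its number in binary. \textbf{Theorem.} There is an algorithm (a Turing machine with finitely many stacks) that, given a Wordle instance $\mathrm{WI}=(\Sigma,d,D,W,g)$, determines whether $\mathrm{WI}$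 admits a winning strategy in time $O(|\mathrm{WI}|^{O(g)})$ and space $O(g\,|\mathrm{WI}|)$, where the implied constants are absolute. In particular, for every fixed game length $g$ it runs in time polynomial in $|\mathrm{WI}|$. -/

import Mathlib

/-- A Wordle instance over the alphabet `α` (a finite type wherever it is used). -/
structure WordleInstance (α : Type) where
  /-- the dimension, i.e. the common length of all words -/
  d : ℕ
  d_pos : 0 < d
  /-- the dictionary of allowed guesses -/
  D : Finset (Fin d → α)
  /-- the list of possible target words -/
  W : Finset (Fin d → α)
  W_subset : W ⊆ D
  /-- the game length -/
  g : ℕ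
  g_pos : 0 < g

namespace WordleInstance

/-- The response `Ω_w(u)` of the Wordle oracle for the target `w` to the query `u`. -/
def response {α : Type} [DecidableEq α] {d : ℕ} (w u : Fin d → α) : Fin d → Fin 3 := fun i =>
  if w i = u i then 2
  else if (Finset.univ.filter fun j : Fin d => j ≤ i ∧ u i = u j ∧ u j ≠ w j).card ≤
      (Finset.univ.filter fun j : Fin d => w j = u i ∧ w j ≠ u j).card then 1
  else 0

variable {α : Type} (WI : WordleInstance α)

/-- A strategy: for every finite sequence of queries and responses, the next query in `D`. -/
abbrev Strategy : Type :=
  List ({u : Fin WI.d → α // u ∈ WI.D} × (Fin WI.d → Fin 3)) → {u : Fin WI.d → α // u ∈ WI.D}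

/-- The first `k` query-response pairs, in order, when the strategy `S` is played against `Ω_w`. -/
def history {WI : WordleInstance α} [DecidableEq α] (S : WI.Strategy) (w : Fin WI.d → α) :
    ℕ → List ({u : Fin WI.d → α // u ∈ WI.D} × (Fin WI.d → Fin 3))
  | 0 => []
  | k + 1 => history S w k ++
      [(S (history S w k), response w (S (history S w k) : Fin WI.d → α))]

/-- Against `Ω_w`, the query made in round `k + 1` (after `k` completed rounds) is answered by
`22⋯2`. -/
def SucceedsInRoundSucc {WI : WordleInstance α} [DecidableEq α] (S : WI.Strategy)
    (w : Fin WI.d → α) (k : ℕ) : Prop :=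
  response w (S (history S w k) : Fin WI.d → α) = fun _ => 2

/-- For every target word the strategy succeeds in one of the rounds `1, …, g`. -/
def IsWinning {WI : WordleInstance α} [DecidableEq α] (S : WI.Strategy) : Prop :=
  ∀ w ∈ WI.W, ∃ k < WI.g, SucceedsInRoundSucc S w k

def HasWinningStrategy [DecidableEq α] : Prop :=
  ∃ S : WI.Strategy, IsWinning S

/-- A concrete presentation of an instance: a numbering of the alphabet by `0, …, |Σ| - 1`, and
the members of `D` and of `W` listed without repetition, in any order. -/
structure Presentation [Fintype α] where
  num : α ≃ Fin (Fintype.card α)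
  dict : List (Fin WI.d → α)
  dict_nodup : dict.Nodup
  mem_dict : ∀ u, u ∈ dict ↔ u ∈ WI.D
  words : List (Fin WI.d → α)
  words_nodup : words.Nodup
  mem_words : ∀ w, w ∈ words ↔ w ∈ WI.W

open Computability (Γ')

/-- A number, as its binary digits (least significant first) followed by a comma. -/
def encodeNumber (n : ℕ) : List Γ' :=
  (Nat.bits n).map Γ'.bit ++ [Γ'.comma]

namespace Presentation

variable {WI} [Fintype α] (P : WI.Presentation)

/-- A word, as the bracketed sequence of the numbers of its letters. -/
def encodeWord (u : Fin WI.d → α) : List Γ' :=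
  Γ'.bra :: (List.ofFn u).flatMap (fun a => encodeNumber (P.num a)) ++ [Γ'.ket]

/-- A list of words, as the bracketed sequence of its words. -/
def encodeWords (l : List (Fin WI.d → α)) : List Γ' :=
  Γ'.bra :: l.flatMap P.encodeWord ++ [Γ'.ket]

/-- The input string that describes `(Σ, d, D, W, g)`. -/
def encode : List Γ' :=
  encodeNumber (Fintype.card α) ++ encodeNumber WI.d ++ encodeNumber WI.g ++
    P.encodeWords P.dict ++ P.encodeWords P.words

/-- The size `|WI|` of the presented instance: the length of its description. -/
def size : ℕ := P.encode.length

end Presentation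

end WordleInstance

/-- On input `x`, the machine `M` halts after at most `t` steps with the correct truth value of `P`
as its output. -/
def DecidesInTime {Γ₀ : Type} (M : Turing.TM2ComputableAux Γ₀ Bool) (x : List Γ₀) (P : Prop)
    (t : ℕ) : Prop :=
  ∃ b : Bool, (b = true ↔ P) ∧
    Nonempty (Turing.TM2OutputsInTime M.tm (x.map M.inputAlphabet.symm)
      (some [M.outputAlphabet.symm b]) t)

/-- On input `x`, in no configuration that `M` reaches do its stacks (the input stack included)
hold more than `s` symbols altogether. -/
def RunsInSpace {Γ₀ : Type} (M : Turing.TM2ComputableAux Γ₀ Bool) (x : List Γ₀) (s : ℕ) : Prop :=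
  ∀ C : M.tm.Cfg,
    StateTransition.Reaches M.tm.step (Turing.initList M.tm (x.map M.inputAlphabet.symm)) C →
      ∑ k ∈ @Finset.univ M.tm.K M.tm.kFin, (C.stk k).length ≤ s

/-! A response matters only through the set of words that would have produced it. The oracle's move
in a round can therefore be recorded as a word `w` of the word list standing for the response
`Ω_w(u)`, and a strategy exists iff an alternating formula `∃ u₁ ∈ D, ∀ w₁ ∈ W, …, ∃ u_g ∈ D, ∀ w_g
∈ W` holds (`Forced`, `hasWinningStrategy_iff_forced`). The intermediate words need not be
consistent with one another. It suffices that the matrix tests the last one: the guesser loses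
exactly if `w_g` gives the recorded response in every round and was never asked. Such a `w_g` is a
target that defeats the strategy.

The formula is evaluated by depth-first search in a tree of depth `2 * g`. One stack keeps, for each
level, the list of choices not yet exhausted, with the current choice in front. This is at most `2 *
g` sublists of the dictionary or the word list, hence `O(g * |WI|)` symbols. The number of traversal
steps is governed by `(|D| * |W|) ^ g`. Both quantifiers are treated alike by giving each level the
value "some child is false" (`iter_level`); two such levels amount to `∃ ∀` (`iter_rounds`).

The rest makes this an actual machine. Structured programs over stacks have a big-step semantics
`Runs B N`, in which `B` bounds each stack and `N` the iterations of each loop. They compile to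
stack machines (`path_of_runs`, `decider_spec`). Since the program is fixed, its running time is
polynomial in `N` (`stepBound_le`); so `N = |WI| ^ O(g)` gives the time bound and `B = O(g * |WI|)`
the space bound, even though every inner loop is crudely charged `N` iterations. -/

open Computability (Γ')

/-! ### A structured language for stack machines -/

namespace StackProg

/-- A path of exactly `n` steps of the partial step function `f`, all of whose configurations are
`good`. -/
inductive Path {C : Type} (f : C → Option C) (good : C → Prop) : ℕ → C → C → Prop
  | refl {c : C} : good c → Path f good 0 c c
  | cons {n : ℕ} {c c' c'' : C} : good c → f c = some c' → Path f good n c' c'' →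
      Path f good (n + 1) c c''

namespace Path

variable {C : Type} {f : C → Option C} {good : C → Prop}

theorem trans {m n : ℕ} {a b c : C} (h : Path f good m a b) (h' : Path f good n b c) :
    Path f good (m + n) a c := by
  induction h with
  | refl => simpa using h'
  | cons hg hs _ ih => rw [Nat.add_right_comm]; exact .cons hg hs (ih h')

theorem single {a b : C} (ha : good a) (hb : good b) (h : f a = some b) : Path f good 1 a b :=
  .cons ha h (.refl hb)

theorem mono {good' : C → Prop} (hg : ∀ c, good c → good' c) {n : ℕ} {a b : C}
    (h : Path f good n a b) : Path f good' n a b := by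
  induction h with
  | refl h => exact .refl (hg _ h)
  | cons h hs _ ih => exact .cons (hg _ h) hs ih

theorem iterate {n : ℕ} {a b : C} (h : Path f good n a b) :
    (flip bind f)^[n] (some a) = some b := by
  induction h with
  | refl => rfl
  | cons _ hs _ ih => rw [Function.iterate_succ_apply, ← ih]; simp [flip, hs]

/-- If the path ends in a halting configuration, it contains everything that can be reached. -/
theorem good_of_reaches {n : ℕ} {a b : C} (h : Path f good n a b) (hb : f b = none) {c : C}
    (hc : StateTransition.Reaches f a c) : good c := by
  induction h with
  | refl hg =>
    rcases Relation.ReflTransGen.cases_head hc with rfl | ⟨d, hd, _⟩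
    · exact hg
    · simp [hb] at hd
  | cons hg hs _ ih =>
    rcases Relation.ReflTransGen.cases_head hc with rfl | ⟨d, hd, hdc⟩
    · exact hg
    · rw [hs, Option.mem_some_iff] at hd
      subst hd
      exact ih hb hdc

end Path

/-- `Iter R n a b`: there is a chain of `n` steps of the relation `R` from `a` to `b`. -/
inductive Iter {S : Type} (R : S → S → Prop) : ℕ → S → S → Prop
  | zero (a : S) : Iter R 0 a a
  | succ {n : ℕ} {a b c : S} : R a b → Iter R n b c → Iter R (n + 1) a c

namespace Iter

variable {S : Type} {R : S → S → Prop}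

theorem trans {m n : ℕ} {a b c : S} (h : Iter R m a b) (h' : Iter R n b c) :
    Iter R (m + n) a c := by
  induction h with
  | zero => simpa using h'
  | succ hs _ ih => rw [Nat.add_right_comm]; exact .succ hs (ih h')

theorem single {a b : S} (h : R a b) : Iter R 1 a b := .succ h (.zero b)

end Iter

/-- Structured programs over stacks indexed by `K` with the alphabet `A` and a memory `σ`. -/
inductive Prog (K A σ : Type)
  | load (f : σ → σ) : Prog K A σ
  | push (k : K) (f : σ → A) : Prog K A σ
  | pop (k : K) (f : σ → Option A → σ) : Prog K A σ
  | seq (p q : Prog K A σ) : Prog K A σ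
  | ite (c : σ → Bool) (p q : Prog K A σ) : Prog K A σ
  | loop (c : σ → Bool) (p : Prog K A σ) : Prog K A σ

scoped infixr:60 " ;; " => Prog.seq

/-- The memory and the stacks. -/
structure State (K A σ : Type) where
  var : σ
  stk : K → List A

/-! ### Big-step semantics with bounds for stacks and loops. -/

section Semantics

variable {K A σ : Type} [DecidableEq K]

/-- `Runs B N p s t`: started in `s`, the program `p` terminates in `t`, no push makes a stack
longer than `B`, and every loop makes at most `N` iterations whenever it is entered. -/
def Runs (B N : ℕ) : Prog K A σ → State K A σ → State K A σ → Prop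
  | .load f, s, t => t = ⟨f s.var, s.stk⟩
  | .push k f, s, t => (s.stk k).length < B ∧
      t = ⟨s.var, Function.update s.stk k (f s.var :: s.stk k)⟩
  | .pop k f, s, t =>
      t = ⟨f s.var (s.stk k).head?, Function.update s.stk k (s.stk k).tail⟩
  | .seq p q, s, t => ∃ m, Runs B N p s m ∧ Runs B N q m t
  | .ite c p q, s, t => (c s.var = true → Runs B N p s t) ∧ (c s.var = false → Runs B N q s t)
  | .loop c p, s, t => ∃ n ≤ N, Iter (fun a b => c a.var = true ∧ Runs B N p a b) n s t ∧
      c t.var = false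

/-- A bound for the number of steps, in terms of a bound for the iterations of each loop. -/
def stepBound (N : ℕ) : Prog K A σ → ℕ
  | .load _ => 1
  | .push _ _ => 1
  | .pop _ _ => 1
  | .seq p q => stepBound N p + stepBound N q
  | .ite _ p q => 1 + (stepBound N p + stepBound N q)
  | .loop _ p => N * (1 + stepBound N p) + 1

omit [DecidableEq K] in
-- The constants depend on the program alone, so a single program for all instances costs polynomial
-- time in its largest loop count.
theorem stepBound_le (p : Prog K A σ) : ∃ c r : ℕ, ∀ N, stepBound N p ≤ c * (N + 1) ^ r := by
  -- Exponents are added rather than maximised; any fixed exponent will do.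
  have key : ∀ c c' r r' N : ℕ,
      c * (N + 1) ^ r + c' * (N + 1) ^ r' ≤ (c + c') * (N + 1) ^ (r + r') := by
    intro c c' r r' N
    rw [add_mul]
    gcongr <;> omega
  induction p with
  | load | push | pop => exact ⟨1, 0, fun N => by simp [stepBound]⟩
  | seq p q hp hq =>
    obtain ⟨c, r, h⟩ := hp
    obtain ⟨c', r', h'⟩ := hq
    exact ⟨c + c', r + r', fun N => (Nat.add_le_add (h N) (h' N)).trans (key _ _ _ _ _)⟩
  | ite _ p q hp hq =>
    obtain ⟨c, r, h⟩ := hp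
    obtain ⟨c', r', h'⟩ := hq
    refine ⟨1 + (c + c'), 0 + (r + r'), fun N => ?_⟩
    refine le_trans ?_ (key _ _ _ _ _)
    simp only [stepBound, pow_zero, mul_one]
    exact Nat.add_le_add_left ((Nat.add_le_add (h N) (h' N)).trans (key _ _ _ _ _)) _
  | loop _ p hp =>
    obtain ⟨c, r, h⟩ := hp
    refine ⟨c + 2, r + 1, fun N => ?_⟩
    have h1 : 1 ≤ (N + 1) ^ r := Nat.one_le_pow _ _ (by omega)
    have h2 := h N
    calc N * (1 + stepBound N p) + 1 ≤ (N + 1) * (1 + stepBound N p) + 1 := by gcongr; omega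
      _ ≤ (N + 1) * ((N + 1) ^ r + c * (N + 1) ^ r) + (N + 1) * (N + 1) ^ r := by
        gcongr
        nlinarith
      _ = (c + 2) * (N + 1) ^ (r + 1) := by ring

end Semantics

/-! ### Compilation to stack machines. -/

section Compile

variable {K A σ : Type}

/-- The labels of the code of a program. -/
def Lab : Prog K A σ → Type
  | .load _ => Unit
  | .push _ _ => Unit
  | .pop _ _ => Unit
  | .seq p q => Lab p ⊕ Lab q
  | .ite _ p q => Unit ⊕ (Lab p ⊕ Lab q)
  | .loop _ p => Unit ⊕ Lab p

theorem finite_lab : ∀ p : Prog K A σ, Finite (Lab p)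
  | .load _ => inferInstanceAs (Finite Unit)
  | .push _ _ => inferInstanceAs (Finite Unit)
  | .pop _ _ => inferInstanceAs (Finite Unit)
  | .seq p q =>
    have := finite_lab p
    have := finite_lab q
    inferInstanceAs (Finite (Lab p ⊕ Lab q))
  | .ite _ p q =>
    have := finite_lab p
    have := finite_lab q
    inferInstanceAs (Finite (Unit ⊕ (Lab p ⊕ Lab q)))
  | .loop _ p =>
    have := finite_lab p
    inferInstanceAs (Finite (Unit ⊕ Lab p))

/-- The label at which a program starts. -/
def entry : (p : Prog K A σ) → Lab p
  | .load _ => ()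
  | .push _ _ => ()
  | .pop _ _ => ()
  | .seq p _ => .inl (entry p)
  | .ite _ _ _ => .inl ()
  | .loop _ _ => .inl ()

/-- The alphabets of the machine: the working stacks `some k`, and the output stack `none`. -/
abbrev Alph (K A : Type) : Option K → Type
  | none => Bool
  | some _ => A

open Turing.TM2 in
/-- The code of a program, for an embedding `e` of its labels into those of the whole machine and
a label `x` at which to continue. -/
def code {Λ : Type} : (p : Prog K A σ) → (Lab p → Λ) → Λ → Lab p → Stmt (Alph K A) Λ σ
  | .load f, _, x, _ => .load f (.goto fun _ => x)
  | .push k f, _, x, _ => .push (some k) f (.goto fun _ => x)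
  | .pop k f, _, x, _ => .pop (some k) f (.goto fun _ => x)
  | .seq p q, e, x, l =>
    Sum.elim (code p (fun l => e (.inl l)) (e (.inr (entry q)))) (code q (fun l => e (.inr l)) x) l
  | .ite c p q, e, x, l =>
    Sum.elim (fun _ => .branch c (.goto fun _ => e (.inr (.inl (entry p))))
        (.goto fun _ => e (.inr (.inr (entry q)))))
      (Sum.elim (code p (fun l => e (.inr (.inl l))) x) (code q (fun l => e (.inr (.inr l))) x)) l
  | .loop c p, e, x, l =>
    Sum.elim (fun _ => .branch c (.goto fun _ => e (.inr (entry p))) (.goto fun _ => x))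
      (code p (fun l => e (.inr l)) (e (.inl ()))) l

/-- The stacks of the machine, with an empty output stack. -/
def machStk (f : K → List A) : ∀ k : Option K, List (Alph K A k)
  | none => []
  | some k => f k

/-- A state of the program as a configuration of the machine. -/
def toCfg {Λ : Type} (l : Λ) (s : State K A σ) : Turing.TM2.Cfg (Alph K A) Λ σ :=
  ⟨some l, s.var, machStk s.stk⟩

variable [DecidableEq K]

theorem update_machStk (f : K → List A) (k : K) (l : List A) :
    Function.update (machStk f) (some k) l = machStk (Function.update f k l) := by
  funext j
  rcases j with _ | j
  · rfl
  · by_cases h : j = k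
    · subst h; simp [machStk]
    · rw [Function.update_of_ne (by simpa using h)]
      simp [machStk, h]

/-- Every working stack holds at most `B` symbols, and the output stack is empty. -/
def Good {Λ : Type} (B : ℕ) (c : Turing.TM2.Cfg (Alph K A) Λ σ) : Prop :=
  ∃ f : K → List A, c.stk = machStk f ∧ ∀ k, (f k).length ≤ B

/-- Correctness of the compiler, by induction on the program with the label embedding `e` and the
exit `x` general: a subprogram occupies a block of labels, and its exit is the entry of whatever
comes next. The body of a loop exits to the test of the same loop. -/
theorem path_of_runs {Λ : Type} {M : Λ → Turing.TM2.Stmt (Alph K A) Λ σ} {B N : ℕ} :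
    ∀ (p : Prog K A σ) (e : Lab p → Λ) (x : Λ), (∀ l, M (e l) = code p e x l) →
    ∀ s t : State K A σ, (∀ k, (s.stk k).length ≤ B) → Runs B N p s t →
      (∀ k, (t.stk k).length ≤ B) ∧ ∃ n ≤ stepBound N p,
        Path (Turing.TM2.step M) (Good B) n (toCfg (e (entry p)) s) (toCfg x t) := by
  have good : ∀ (l : Λ) (s : State K A σ), (∀ k, (s.stk k).length ≤ B) → Good B (toCfg l s) :=
    fun l s h => ⟨s.stk, rfl, h⟩
  intro p
  induction p with
  | load f =>
    rintro e x hM s t hs rfl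
    refine ⟨hs, 1, le_rfl, .single (good _ _ hs) (good _ _ hs) ?_⟩
    simp [toCfg, hM, code]
  | push k f =>
    rintro e x hM s t hs ⟨hk, rfl⟩
    have ht : ∀ j, (Function.update s.stk k (f s.var :: s.stk k) j).length ≤ B := by
      intro j
      by_cases h : j = k
      · subst h; simpa using hk
      · simpa [h] using hs j
    refine ⟨ht, 1, le_rfl, .single (good _ _ hs) (good _ _ ht) ?_⟩
    simp only [toCfg, Turing.TM2.step, hM, code, Turing.TM2.stepAux]
    exact congrArg (fun S => some (Turing.TM2.Cfg.mk (some x) s.var S)) (update_machStk _ _ _)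
  | pop k f =>
    rintro e x hM s t hs rfl
    have ht : ∀ j, (Function.update s.stk k (s.stk k).tail j).length ≤ B := by
      intro j
      by_cases h : j = k
      · subst h; simpa using (Nat.sub_le _ _).trans (hs j)
      · simpa [h] using hs j
    refine ⟨ht, 1, le_rfl, .single (good _ _ hs) (good _ _ ht) ?_⟩
    simp only [toCfg, Turing.TM2.step, hM, code, Turing.TM2.stepAux]
    exact congrArg (fun S => some (Turing.TM2.Cfg.mk (some x) _ S)) (update_machStk _ _ _)
  | seq p q hp hq =>
    rintro e x hM s t hs ⟨m, h1, h2⟩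
    obtain ⟨hm, n1, hn1, p1⟩ := hp (fun l => e (.inl l)) (e (.inr (entry q)))
      (fun l => hM (.inl l)) s m hs h1
    obtain ⟨ht, n2, hn2, p2⟩ := hq (fun l => e (.inr l)) x (fun l => hM (.inr l)) m t hm h2
    exact ⟨ht, n1 + n2, Nat.add_le_add hn1 hn2, p1.trans p2⟩
  | ite c p q hp hq =>
    rintro e x hM s t hs ⟨h1, h2⟩
    have hl := hM (.inl ())
    cases hc : c s.var with
    | true =>
      obtain ⟨ht, n, hn, p1⟩ := hp (fun l => e (.inr (.inl l))) x (fun l => hM (.inr (.inl l)))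
        s t hs (h1 hc)
      refine ⟨ht, n + 1, by simp only [stepBound]; omega, .cons (good _ _ hs) ?_ p1⟩
      simp [toCfg, entry, hl, code, hc]
    | false =>
      obtain ⟨ht, n, hn, p1⟩ := hq (fun l => e (.inr (.inr l))) x (fun l => hM (.inr (.inr l)))
        s t hs (h2 hc)
      refine ⟨ht, n + 1, by simp only [stepBound]; omega, .cons (good _ _ hs) ?_ p1⟩
      simp [toCfg, entry, hl, code, hc]
  | loop c p hp =>
    rintro e x hM s t hs ⟨n, hn, hi, hc⟩
    have hl := hM (.inl ())
    have key : (∀ k, (t.stk k).length ≤ B) ∧ ∃ n' ≤ n * (1 + stepBound N p) + 1,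
        Path (Turing.TM2.step M) (Good B) n' (toCfg (e (entry (.loop c p))) s) (toCfg x t) := by
      -- The inner induction is on the chain of iterations; the bound by `N` is applied to its
      -- length afterwards.
      clear hn
      induction hi with
      | zero a =>
        refine ⟨hs, 1, by omega, .single (good _ _ hs) (good _ _ hs) ?_⟩
        simp [toCfg, entry, hl, code, hc]
      | @succ n a b _ hab _ ih =>
        obtain ⟨hb, n1, hn1, p1⟩ := hp (fun l => e (.inr l)) (e (.inl ())) (fun l => hM (.inr l))
          a b hs hab.2
        obtain ⟨ht, n2, hn2, p2⟩ := ih hb hc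
        refine ⟨ht, n1 + n2 + 1, ?_, .cons (good _ _ hs) ?_ (p1.trans p2)⟩
        · rw [Nat.succ_mul]; omega
        · simp [toCfg, entry, hl, code, hab.1]
    obtain ⟨ht, n', hn', p1⟩ := key
    exact ⟨ht, n', hn'.trans (Nat.add_le_add_right (Nat.mul_le_mul_right _ hn) _), p1⟩

end Compile

/-! ### From a terminating program to a decider. -/

section Machine

theorem initList_stk (M : Turing.FinTM2) (l : List (M.Γ M.k₀)) :
    (Turing.initList M l).stk = Function.update (fun _ => []) M.k₀ l := by
  funext k
  by_cases h : k = M.k₀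
  · subst h; simp [Turing.initList]
  · simp [Turing.initList, h]

theorem haltList_stk (M : Turing.FinTM2) (l : List (M.Γ M.k₁)) :
    (Turing.haltList M l).stk = Function.update (fun _ => []) M.k₁ l := by
  funext k
  by_cases h : k = M.k₁
  · subst h; simp [Turing.haltList]
  · simp [Turing.haltList, h]

theorem machStk_nil {K A : Type} : machStk (fun _ : K => ([] : List A)) = fun _ => [] := by
  funext k
  cases k <;> rfl

variable {K A σ : Type} [DecidableEq K] [Fintype K] [Fintype A] [Fintype σ]

/-- The machine that runs `p` on the input in the stack `k₀`, and then writes a truth value. -/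
noncomputable def machine (p : Prog K A σ) (k₀ : K) (v₀ : σ) (out : σ → Bool) : Turing.FinTM2 where
  K := Option K
  k₀ := some k₀
  k₁ := none
  Γ := Alph K A
  Λ := Option (Lab p)
  main := some (entry p)
  ΛFin := have := finite_lab p; Fintype.ofFinite _
  σ := σ
  initialState := v₀
  Γk₀Fin := inferInstanceAs (Fintype A)
  m
    | some l => code p some none l
    | none => .push none out (.load (fun _ => v₀) .halt)

/-- The machine of a program, with the identity as the encoding of the alphabets. -/
noncomputable def decider (p : Prog K A σ) (k₀ : K) (v₀ : σ) (out : σ → Bool) :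
    Turing.TM2ComputableAux A Bool where
  tm := machine p k₀ v₀ out
  inputAlphabet := Equiv.refl A
  outputAlphabet := Equiv.refl Bool

/-- The program must end with all stacks empty, because a halting configuration in the required form
holds nothing but the output. One further step writes the answer and resets the memory, which
accounts for both summands `+ 1`. The space bound covers all reachable configurations because the
machine is deterministic and its path ends in a halt. -/
theorem decider_spec {p : Prog K A σ} {k₀ : K} {v₀ v : σ} {out : σ → Bool} {B N : ℕ} {x : List A}
    (hx : x.length ≤ B)
    (h : Runs B N p ⟨v₀, Function.update (fun _ => []) k₀ x⟩ ⟨v, fun _ => []⟩) :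
    (∀ P : Prop, (out v = true ↔ P) →
      DecidesInTime (decider p k₀ v₀ out) x P (stepBound N p + 1)) ∧
    RunsInSpace (decider p k₀ v₀ out) x (Fintype.card K * B + 1) := by
  have hs : ∀ k, (Function.update (fun _ => ([] : List A)) k₀ x k).length ≤ B := by
    intro k
    by_cases hk : k = k₀
    · subst hk; simpa using hx
    · simp [hk]
  obtain ⟨_, n, hn, hp⟩ := path_of_runs (M := (machine p k₀ v₀ out).m) p some none
    (fun _ => rfl) _ _ hs h
  have hinit : Turing.initList (machine p k₀ v₀ out)
      (x.map (decider p k₀ v₀ out).inputAlphabet.symm) =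
      toCfg (some (entry p)) ⟨v₀, Function.update (fun _ => []) k₀ x⟩ := by
    have h1 := initList_stk (machine p k₀ v₀ out)
      (x.map (decider p k₀ v₀ out).inputAlphabet.symm)
    refine congrArg (Turing.TM2.Cfg.mk _ _) (h1.trans ?_)
    refine Eq.trans ?_ (update_machStk (fun _ => []) k₀ x)
    rw [machStk_nil]
    exact congrArg (Function.update (fun _ => []) (some k₀)) (List.map_id x)
  have hhalt : (Turing.TM2.step (machine p k₀ v₀ out).m)
      (toCfg none ⟨v, fun _ => []⟩) = some (Turing.haltList (machine p k₀ v₀ out) [out v]) := by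
    refine congrArg (fun S => some (Turing.TM2.Cfg.mk none v₀ S)) ?_
    refine Eq.trans ?_ (haltList_stk (machine p k₀ v₀ out) [out v]).symm
    change Function.update (machStk fun _ => []) none [out v] = _
    rw [machStk_nil]
    rfl
  set good' : (machine p k₀ v₀ out).Cfg → Prop := fun C =>
    ∑ k ∈ @Finset.univ (machine p k₀ v₀ out).K (machine p k₀ v₀ out).kFin, (C.stk k).length ≤
      Fintype.card K * B + 1 with hgood'
  have hg : ∀ C, Good B C → good' C := by
    rintro C ⟨f, hf, hB⟩
    rw [hgood']
    simp only [hf]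
    change ∑ k : Option K, (machStk f k).length ≤ _
    rw [Fintype.sum_option]
    have := Finset.sum_le_card_nsmul Finset.univ (fun k => (f k).length) B (fun k _ => hB k)
    simp only [machStk, List.length_nil, smul_eq_mul, Finset.card_univ] at this ⊢
    omega
  have hg' : good' (Turing.haltList (machine p k₀ v₀ out) [out v]) := by
    rw [hgood']
    simp only [haltList_stk]
    change ∑ k : Option K, (Function.update (fun k : Option K => ([] : List (Alph K A k))) none
      [out v] k).length ≤ _
    rw [Fintype.sum_option]
    simp
  have hpath : Path (machine p k₀ v₀ out).step good' (n + 1)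
      (Turing.initList (machine p k₀ v₀ out)
        (x.map (decider p k₀ v₀ out).inputAlphabet.symm))
      (Turing.haltList (machine p k₀ v₀ out) [out v]) := by
    rw [hinit]
    exact (hp.mono hg).trans (.single (hg _ ⟨_, rfl, by simp⟩) hg' hhalt)
  refine ⟨fun P hP => ⟨out v, hP, ⟨⟨⟨n + 1, hpath.iterate⟩, Nat.succ_le_succ hn⟩⟩⟩, fun C hC => ?_⟩
  exact hpath.good_of_reaches rfl hC

end Machine

end StackProg

namespace WordleInstance

/-! ### Winning strategies as an alternating formula. -/

section Game

variable {α : Type} [DecidableEq α]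

theorem response_eq_two_iff {d : ℕ} (w u : Fin d → α) (i : Fin d) :
    response w u i = 2 ↔ w i = u i := by
  unfold response
  split_ifs with h h'
  · simp [h]
  · simp [h]
  · simp [h]

theorem response_eq_const_two_iff {d : ℕ} (w u : Fin d → α) :
    response w u = (fun _ => 2) ↔ w = u := by
  simp only [funext_iff, response_eq_two_iff]

/-- `Consistent h w`: for each pair `(u, w')` in `h`, the query `u` gets from `w` the same response
as from `w'`, and is not `w` itself. -/
def Consistent {d : ℕ} (h : List ((Fin d → α) × (Fin d → α))) (w : Fin d → α) : Prop :=
  ∀ p ∈ h, response w p.1 = response p.2 p.1 ∧ w ≠ p.1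

theorem consistent_cons {d : ℕ} {u v w : Fin d → α} {h : List ((Fin d → α) × (Fin d → α))} :
    Consistent ((u, v) :: h) w ↔ (response w u = response v u ∧ w ≠ u) ∧ Consistent h w := by
  simp [Consistent]

/-- The alternating formula for a win in `n` more rounds. The rounds played so far are listed with
the latest one first; each is given by its query and a word that yields its response. -/
def Forced (WI : WordleInstance α) : ℕ → List ((Fin WI.d → α) × (Fin WI.d → α)) → Prop
  | 0, [] => True
  | 0, p :: h => ¬ Consistent (p :: h) p.2
  | n + 1, h => ∃ u ∈ WI.D, ∀ w ∈ WI.W, Forced WI n ((u, w) :: h)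

variable {WI : WordleInstance α}

/-- Histories grow at the end, whereas induction on the game removes the first round. What remains
is the history of the strategy that has the first round built in. -/
theorem history_succ (S : WI.Strategy) (w : Fin WI.d → α) (k : ℕ) :
    history S w (k + 1) = (S [], response w (S [] : Fin WI.d → α)) ::
      history (fun t => S ((S [], response w (S [] : Fin WI.d → α)) :: t)) w k := by
  induction k with
  | zero => rfl
  | succ k ih =>
    rw [history, ih]
    rfl

theorem succeedsInRoundSucc_succ (S : WI.Strategy) (w : Fin WI.d → α) (k : ℕ) :
    SucceedsInRoundSucc S w (k + 1) ↔ SucceedsInRoundSucc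
      (fun t => S ((S [], response w (S [] : Fin WI.d → α)) :: t)) w k := by
  unfold SucceedsInRoundSucc
  rw [history_succ]

theorem succeedsInRoundSucc_zero (S : WI.Strategy) (w : Fin WI.d → α) :
    SucceedsInRoundSucc S w 0 ↔ w = (S [] : Fin WI.d → α) :=
  response_eq_const_two_iff _ _

/-- The strategy supplies the queries. Any word still consistent after the new pair gives the same
first response as `w` and differs from the query, so it is found in a later round by the strategy
shifted past that round. With no rounds left, no consistent word can remain. -/
theorem forced_of_strategy (n : ℕ) : ∀ (h : List ((Fin WI.d → α) × (Fin WI.d → α)))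
    (_ : ∀ p ∈ h, p.2 ∈ WI.W) (S : WI.Strategy)
    (_ : ∀ w ∈ WI.W, Consistent h w → ∃ k < n, SucceedsInRoundSucc S w k), Forced WI n h := by
  induction n with
  | zero =>
    rintro (_ | ⟨p, h⟩) hW S hS
    · trivial
    · intro hp
      obtain ⟨k, hk, _⟩ := hS p.2 (hW p (by simp)) hp
      omega
  | succ n ih =>
    intro h hW S hS
    refine ⟨S [], (S []).2, fun w hw => ?_⟩
    refine ih _ ?_ (fun t => S ((S [], response w (S [] : Fin WI.d → α)) :: t)) ?_
    · simpa using ⟨hw, fun a b => hW (a, b)⟩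
    · intro v hv hc
      obtain ⟨⟨h1, h2⟩, h3⟩ := consistent_cons.1 hc
      obtain ⟨k, hk, hsucc⟩ := hS v hv h3
      rcases k with _ | k
      · exact absurd ((succeedsInRoundSucc_zero _ _).1 hsucc) h2
      · rw [succeedsInRoundSucc_succ, h1] at hsucc
        exact ⟨k, by omega, hsucc⟩

/-- Winning continuations for the recorded words are glued along responses. The count `n + 1`
guarantees a query, so that a strategy exists at all, and keeps the base case away from the empty
history. -/
theorem strategy_of_forced (n : ℕ) : ∀ h : List ((Fin WI.d → α) × (Fin WI.d → α)),
    Forced WI (n + 1) h → ∃ S : WI.Strategy,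
      ∀ w ∈ WI.W, Consistent h w → ∃ k < n + 1, SucceedsInRoundSucc S w k := by
  induction n with
  | zero =>
    rintro h ⟨u, hu, hF⟩
    refine ⟨fun _ => ⟨u, hu⟩, fun w hw hc => ⟨0, by omega, ?_⟩⟩
    rw [succeedsInRoundSucc_zero]
    by_contra hne
    exact hF w hw (consistent_cons.2 ⟨⟨rfl, hne⟩, hc⟩)
  | succ n ih =>
    rintro h ⟨u, hu, hF⟩
    have : Nonempty WI.Strategy := ⟨fun _ => ⟨u, hu⟩⟩
    -- Words with the same response may receive different continuations here.
    choose! S hS using fun w hw => ih _ (hF w hw)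
    classical
    -- A strategy sees only the response, so one word is fixed for each response; the default `u`
    -- serves responses that no word yields.
    let rep : (Fin WI.d → Fin 3) → (Fin WI.d → α) := fun r =>
      if hr : ∃ w ∈ WI.W, response w u = r then hr.choose else u
    refine ⟨fun t => match t with
      | [] => ⟨u, hu⟩
      | (_, r) :: t => S (rep r) t, fun w hw hc => ?_⟩
    by_cases hne : w = u
    · exact ⟨0, by omega, (succeedsInRoundSucc_zero _ _).2 hne⟩
    · have hex : ∃ v ∈ WI.W, response v u = response w u := ⟨w, hw, rfl⟩
      have hrep : rep (response w u) = hex.choose := dif_pos hex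
      obtain ⟨hv, hvw⟩ := hex.choose_spec
      rw [← hrep] at hv hvw
      obtain ⟨k, hk, hsucc⟩ := hS _ hv w hw (consistent_cons.2 ⟨⟨hvw.symm, hne⟩, hc⟩)
      exact ⟨k + 1, by omega, (succeedsInRoundSucc_succ _ _ _).2 hsucc⟩

theorem hasWinningStrategy_iff_forced : WI.HasWinningStrategy ↔ Forced WI WI.g [] := by
  constructor
  · rintro ⟨S, hS⟩
    exact forced_of_strategy _ _ (by simp) S fun w hw _ => hS w hw
  · intro h
    obtain ⟨n, hn⟩ := Nat.exists_eq_add_one.2 WI.g_pos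
    rw [hn] at h
    obtain ⟨S, hS⟩ := strategy_of_forced n [] h
    refine ⟨S, fun w hw => ?_⟩
    rw [hn]
    exact hS w hw (by simp [Consistent])

end Game

end WordleInstance

/-! ### Stacks, memory and basic operations of the Wordle machine. -/

namespace StackProg

/-- The working stacks of the Wordle machine. -/
inductive Stack
  | inp | dict | wrds | frm | aux | rem | tgt | old | qry | tmp | fst | snd | sel | idx | pos | len
  | cnt | num
  deriving DecidableEq

instance : Fintype Stack where
  elems := {.inp, .dict, .wrds, .frm, .aux, .rem, .tgt, .old, .qry, .tmp, .fst, .snd, .sel, .idx,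
    .pos, .len, .cnt, .num}
  complete k := by cases k <;> decide

/-- The finite memory of the Wordle machine. -/
structure Mem where
  cur : Option Γ'
  bit : Bool
  hit : Bool
  eq : Bool
  ok : Bool
  agree : Bool
  differ : Bool
  resp : Fin 3
  prev : Fin 3
  par : Bool
  up : Bool
  val : Bool
  done : Bool

noncomputable instance : Fintype Mem :=
  have : Finite Mem := Finite.of_injective
    (fun v : Mem => (v.cur, v.bit, v.hit, v.eq, v.ok, v.agree, v.differ, v.resp, v.prev, v.par,
      v.up, v.val, v.done)) fun v w h => by
        cases v; cases w; simpa using h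
  Fintype.ofFinite _

abbrev WProg := Prog Stack Γ' Mem

abbrev WState := State Stack Γ' Mem

/-- Pop a symbol into the memory. -/
def popCur (k : Stack) : WProg := .pop k fun v o => { v with cur := o }

/-- Push the symbol in the memory. -/
def pushCur (k : Stack) : WProg := .push k fun v => v.cur.getD Γ'.blank

/-- Push a fixed symbol. -/
def pushSym (k : Stack) (c : Γ') : WProg := .push k fun _ => c

def skip : WProg := .load id

def clearCur : WProg := .load fun v => { v with cur := none }

/-- Pop symbols from `k` and run `body` for each, until a symbol that satisfies `halts` has been
popped or the stack is empty. -/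
def forUntil (k : Stack) (halts : Γ' → Bool) (body : WProg) : WProg :=
  popCur k ;; .loop (fun v => v.cur.any fun c => !halts c) (body ;; popCur k) ;; clearCur

/-- Run `body` for each symbol of the stack `k`. -/
def forEach (k : Stack) (body : WProg) : WProg := forUntil k (fun _ => false) body

/-- The state after the top symbol of `k` has been popped into the memory. -/
def popped (k : Stack) (s : WState) : WState :=
  ⟨{ s.var with cur := (s.stk k).head? }, Function.update s.stk k (s.stk k).tail⟩

variable {B N : ℕ}

theorem Runs.seq {p q : WProg} {s t u : WState} (h : Runs B N p s t) (h' : Runs B N q t u) :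
    Runs B N (p ;; q) s u := ⟨t, h, h'⟩

theorem Runs.congr {p : WProg} {s t t' : WState} (h : Runs B N p s t) (e : t = t') :
    Runs B N p s t' := e ▸ h

theorem Runs.ite_true {c : Mem → Bool} {p q : WProg} {s t : WState} (hc : c s.var = true)
    (h : Runs B N p s t) : Runs B N (.ite c p q) s t :=
  ⟨fun _ => h, fun h' => absurd h' (by simp [hc])⟩

theorem Runs.ite_false {c : Mem → Bool} {p q : WProg} {s t : WState} (hc : c s.var = false)
    (h : Runs B N q s t) : Runs B N (.ite c p q) s t :=
  ⟨fun h' => absurd h' (by simp [hc]), fun _ => h⟩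

theorem runs_load (f : Mem → Mem) (s : WState) : Runs B N (.load f) s ⟨f s.var, s.stk⟩ := rfl

theorem runs_pop (k : Stack) (f : Mem → Option Γ' → Mem) (s : WState) : Runs B N (.pop k f) s
    ⟨f s.var (s.stk k).head?, Function.update s.stk k (s.stk k).tail⟩ := rfl

theorem runs_skip (s : WState) : Runs B N skip s s := rfl

theorem runs_popCur (k : Stack) (s : WState) : Runs B N (popCur k) s (popped k s) := rfl

theorem runs_pushCur {k : Stack} {s : WState} {c : Γ'} (hc : s.var.cur = some c)
    (hk : (s.stk k).length < B) :
    Runs B N (pushCur k) s ⟨s.var, Function.update s.stk k (c :: s.stk k)⟩ :=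
  ⟨hk, by simp [hc]⟩

theorem runs_pushSym {k : Stack} {s : WState} (c : Γ') (hk : (s.stk k).length < B) :
    Runs B N (pushSym k c) s ⟨s.var, Function.update s.stk k (c :: s.stk k)⟩ :=
  ⟨hk, rfl⟩

/-- The rule for loops over a stack. The argument `st p q` is the state after the items `p` have
been processed, when the items `q` are left. -/
theorem runs_forUntil {β : Type} {k : Stack} {halts : Γ' → Bool} {body : WProg} (items : List β)
    (st : List β → List β → WState) (hN : items.length ≤ N)
    (hstep : ∀ p x q, items = p ++ x :: q →
      (∃ c ∈ ((st p (x :: q)).stk k).head?, halts c = false) ∧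
        Runs B N body (popped k (st p (x :: q))) (st (p ++ [x]) q))
    (hend : ∀ c ∈ ((st items []).stk k).head?, halts c = true) :
    Runs B N (forUntil k halts body) (st [] items)
      ⟨{ (st items []).var with cur := none },
        Function.update (st items []).stk k ((st items []).stk k).tail⟩ := by
  have key : ∀ q p, items = p ++ q →
      Iter (fun a b : WState => (a.var.cur.any fun c => !halts c) = true ∧
        Runs B N (body ;; popCur k) a b) q.length (popped k (st p q))
        (popped k (st items [])) := by
    intro q
    induction q with
    | nil => intro p hp; rw [List.append_nil] at hp; subst hp; exact .zero _
    | cons x q ih =>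
      intro p hp
      obtain ⟨⟨c, hc, hs⟩, hrun⟩ := hstep p x q hp
      refine .succ ⟨?_, _, hrun, runs_popCur _ _⟩ (ih (p ++ [x]) (by simpa using hp))
      rw [Option.mem_def] at hc
      simp [popped, hc, hs]
  refine ⟨_, runs_popCur _ _, popped k (st items []), ⟨_, hN, key items [] rfl, ?_⟩, rfl⟩
  cases hh : ((st items []).stk k).head? with
  | none => simp [popped, hh]
  | some c => simp [popped, hh, hend c hh]

/-- The rule for loops over a stack of marks; the argument of `st` is the number of marks left. -/
theorem runs_forMarks {k : Stack} {body : WProg} (n : ℕ) (st : ℕ → WState) (hN : n ≤ N)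
    (hstk : ∀ m ≤ n, (st m).stk k = List.replicate m Γ'.blank)
    (hstep : ∀ m < n, Runs B N body
      ⟨{ (st (m + 1)).var with cur := some Γ'.blank },
        Function.update (st (m + 1)).stk k (List.replicate m Γ'.blank)⟩ (st m)) :
    Runs B N (forEach k body) (st n) ⟨{ (st 0).var with cur := none }, (st 0).stk⟩ := by
  have h := runs_forUntil (B := B) (N := N) (k := k) (halts := fun _ => false) (body := body)
    (List.replicate n ()) (fun _ q => st q.length) (by simpa using hN) ?_ ?_
  · have h0 := hstk 0 (Nat.zero_le _)
    simp only [List.length_replicate, List.length_nil, h0, List.replicate_zero, List.tail_nil] at h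
    refine h.congr ?_
    have : Function.update (st 0).stk k [] = (st 0).stk := by
      rw [Function.update_eq_self_iff, h0]; rfl
    rw [this]
  · intro p x q hq
    have hlen : q.length + 1 ≤ n := by
      have := congrArg List.length hq
      simp at this
      omega
    have h1 := hstk _ hlen
    refine ⟨⟨Γ'.blank, by simp [h1, List.replicate_succ], rfl⟩, ?_⟩
    have h2 := hstep q.length hlen
    simpa [popped, h1, List.replicate_succ] using h2
  · simp [hstk 0]

/-- Push the symbol in the memory to each stack of a list. -/
def pushAll : List Stack → WProg
  | [] => skip
  | k :: ks => pushCur k ;; pushAll ks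

/-- Move symbols from `k` to each of the stacks `ks`. -/
def move (k : Stack) (halts : Γ' → Bool) (ks : List Stack) : WProg := forUntil k halts (pushAll ks)

theorem runs_pushAll {c : Γ'} (ks : List Stack) (hks : ks.Nodup) (s : WState)
    (hc : s.var.cur = some c) (hB : ∀ j ∈ ks, (s.stk j).length < B) :
    Runs B N (pushAll ks) s ⟨s.var, fun j => if j ∈ ks then c :: s.stk j else s.stk j⟩ := by
  induction ks generalizing s with
  | nil => exact (runs_skip s).congr (by simp)
  | cons k ks ih =>
    rw [List.nodup_cons] at hks
    refine Runs.seq (runs_pushCur hc (hB k (by simp))) ?_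
    refine (ih hks.2 _ (by exact hc) ?_).congr ?_
    · intro j hj
      have : j ≠ k := by rintro rfl; exact hks.1 hj
      simpa [this] using hB j (by simp [hj])
    · congr 1
      funext j
      by_cases h : j = k
      · subst h; simp [hks.1]
      · simp [h]

/-- The symbol that stops the move is consumed as well, hence `rest.tail`. Each move reverses the
order, so copies that must keep their order pass through a second stack. -/
theorem runs_move {k : Stack} {halts : Γ' → Bool} {ks : List Stack} {s : WState} (l rest : List Γ')
    (hk : s.stk k = l ++ rest) (hl : ∀ c ∈ l, halts c = false)
    (hrest : ∀ c ∈ rest.head?, halts c = true) (hN : l.length ≤ N)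
    (hB : ∀ j ∈ ks, l.length + (s.stk j).length ≤ B)
    (hks : ks.Nodup := by simp) (hmem : k ∉ ks := by simp) :
    Runs B N (move k halts ks) s ⟨{ s.var with cur := none },
      fun j => if j = k then rest.tail else if j ∈ ks then l.reverse ++ s.stk j else s.stk j⟩ := by
  cases l with
  | nil =>
    have h := runs_forUntil (B := B) (N := N) (k := k) (halts := halts) (body := pushAll ks)
      ([] : List Γ') (fun _ _ => s) (by simp) (by simp) (by simpa [hk] using hrest)
    refine h.congr ?_
    congr 1
    funext j
    by_cases hj : j = k
    · subst hj; simp_all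
    · simp [hj]
  | cons c0 l0 =>
  set l := c0 :: l0 with hl0
  have h := runs_forUntil (B := B) (N := N) (k := k) (halts := halts) (body := pushAll ks) l
    (fun p q => ⟨{ s.var with cur := if p = [] then s.var.cur else p.getLast? },
      fun j => if j = k then q ++ rest else if j ∈ ks then p.reverse ++ s.stk j else s.stk j⟩)
    hN ?_ (by simpa using hrest)
  · have e : (⟨{ s.var with cur := if ([] : List Γ') = [] then s.var.cur else ([] : List Γ').getLast? },
      fun j => if j = k then l ++ rest else if j ∈ ks then ([] : List Γ').reverse ++ s.stk j
        else s.stk j⟩ : WState) = s := by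
      have : (fun j => if j = k then l ++ rest else if j ∈ ks then ([] : List Γ').reverse ++ s.stk j
        else s.stk j) = s.stk := by
        funext j
        by_cases hj : j = k
        · subst hj; simp [hk]
        · simp [hj]
      rw [this]
      rfl
    rw [e] at h
    refine h.congr ?_
    congr 1
    funext j
    by_cases hj : j = k
    · subst hj; simp
    · simp [hj]
  · intro p c q hq
    refine ⟨⟨c, by simp, hl c (by simp [hq])⟩, ?_⟩
    refine (runs_pushAll (c := c) ks hks _ (by simp [popped]) ?_).congr ?_
    · intro j hj
      have hjk : j ≠ k := by rintro rfl; exact hmem hj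
      have h1 := hB j hj
      have h2 := congrArg List.length hq
      simp [popped, hjk, hj] at h2 ⊢
      omega
    · simp only [popped]
      congr 1
      · simp
      · funext j
        by_cases hj : j = k
        · subst hj; simp [hmem]
        · by_cases hj' : j ∈ ks <;> simp [hj, hj']

/-- Copy the stack `a` to the stack `b`. -/
def copy (a b : Stack) : WProg :=
  move a (fun _ => false) [.tmp] ;; move .tmp (fun _ => false) [a, b]

theorem runs_copy {a b : Stack} {s : WState} (htmp : s.stk .tmp = [])
    (hN : (s.stk a).length ≤ N) (hB : (s.stk a).length + (s.stk b).length ≤ B)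
    (hab : a ≠ b := by decide) (ha : a ≠ .tmp := by decide) (hb : b ≠ .tmp := by decide) :
    Runs B N (copy a b) s
      ⟨{ s.var with cur := none }, Function.update s.stk b (s.stk a ++ s.stk b)⟩ := by
  refine (runs_move (s.stk a) [] (by simp) (by simp) (by simp) hN (by simp [htmp]; omega)
    (by simp) (by simpa using ha)).seq
    ((runs_move (s.stk a).reverse [] (by simp [ha.symm, htmp]) (by simp) (by simp) (by simpa using hN)
      ?_ (by simpa using hab) (by simp [ha.symm, hb.symm])).congr ?_)
  · intro j hj
    simp at hj
    rcases hj with rfl | rfl <;> simp [hb, hab.symm]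
    · omega
    · omega
  · congr 1
    funext j
    by_cases h1 : j = b
    · subst h1; simp [hb, hab.symm]
    · by_cases h2 : j = .tmp
      · subst h2; simp [htmp, h1]
      · by_cases h3 : j = a
        · subst h3; simp [h1, h2]
        · simp [h1, h2, h3]

/-- Empty a stack. -/
def clear (k : Stack) : WProg := move k (fun _ => false) []

theorem runs_clear {k : Stack} {s : WState} (hN : (s.stk k).length ≤ N) :
    Runs B N (clear k) s ⟨{ s.var with cur := none }, Function.update s.stk k []⟩ := by
  refine (runs_move (s.stk k) [] (by simp) (by simp) (by simp) hN (by simp)).congr ?_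
  congr 1
  funext j
  by_cases h : j = k
  · subst h; simp
  · simp [h]


/-! ### Fetching and comparing single letters. -/

open WordleInstance (encodeNumber)

variable {B N : ℕ}

/-- The letters of a word, as they are written on a stack. -/
def letters (L : List ℕ) : List Γ' := L.flatMap encodeNumber

theorem letters_cons (x : ℕ) (L : List ℕ) : letters (x :: L) = encodeNumber x ++ letters L := rfl

/-- Take a mark from the stack `sel`, and note whether it is the one at the bottom. -/
def tick : WProg := .pop .sel fun v o => { v with hit := decide (o = some Γ'.ket) }

/-- Write the letter of the word in `a` whose position is given in unary in `i` to `dst`, with the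
digits in the opposite order. -/
def fetch (a i dst : Stack) : WProg :=
  pushSym .sel Γ'.ket ;; copy i .sel ;; tick ;;
  forEach a (pushCur .tmp ;;
    .ite (fun v => v.cur = some Γ'.comma) tick (.ite (fun v => v.hit) (pushCur dst) skip)) ;;
  move .tmp (fun _ => false) [a]

/-- The effect of one symbol on the marks and on the letter that is fetched. -/
def fetchStep (x : List Γ' × List Γ') (c : Γ') : List Γ' × List Γ' :=
  if c = Γ'.comma then (x.1.tail, x.2)
  else if x.1.head? = some Γ'.ket then (x.1, c :: x.2) else x

/-- Digits are collected only while `ket` is the top mark, and the comma that ends the letter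
removes one mark. So `n` blanks above a `ket` select the letter at position `n`, and nothing once
the `ket` is gone. -/
theorem foldl_fetchStep_encodeNumber (n : ℕ) (m d : List Γ') :
    (encodeNumber n).foldl fetchStep (m, d) =
      (m.tail, if m.head? = some Γ'.ket then ((Nat.bits n).map Γ'.bit).reverse ++ d else d) := by
  have key : ∀ (l : List Bool) (d : List Γ'), (l.map Γ'.bit).foldl fetchStep (m, d) =
      (m, if m.head? = some Γ'.ket then (l.map Γ'.bit).reverse ++ d else d) := by
    intro l
    induction l with
    | nil => simp
    | cons b l ih =>
      intro d
      by_cases h : m.head? = some Γ'.ket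
      · simp only [h, if_true] at ih
        simp [fetchStep, h, ih]
      · simp only [h, if_false] at ih
        simp [fetchStep, h, ih]
  rw [encodeNumber, List.foldl_append, key]
  simp [fetchStep]

theorem foldl_fetchStep_nil (L : List ℕ) (d : List Γ') :
    (letters L).foldl fetchStep ([], d) = ([], d) := by
  induction L with
  | nil => rfl
  | cons x L ih =>
    rw [letters_cons, List.foldl_append, foldl_fetchStep_encodeNumber]
    simpa using ih

theorem foldl_fetchStep (L : List ℕ) (n x : ℕ) (h : L[n]? = some x) :
    (letters L).foldl fetchStep (List.replicate n Γ'.blank ++ [Γ'.ket], []) =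
      ([], ((Nat.bits x).map Γ'.bit).reverse) := by
  induction L generalizing n with
  | nil => simp at h
  | cons y L ih =>
    rw [letters_cons, List.foldl_append, foldl_fetchStep_encodeNumber]
    cases n with
    | zero =>
      simp only [List.getElem?_cons_zero, Option.some.injEq] at h
      subst h
      simpa using foldl_fetchStep_nil L _
    | succ n =>
      simpa [List.replicate_succ] using ih n (by simpa using h)

theorem length_foldl_fetchStep (p m d : List Γ') :
    (p.foldl fetchStep (m, d)).2.length ≤ p.length + d.length := by
  induction p generalizing m d with
  | nil => simp
  | cons c p ih =>
    rw [List.foldl_cons, fetchStep]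
    split_ifs
    · exact (ih _ _).trans (by simp)
    · exact (ih _ _).trans (by simp; omega)
    · exact (ih _ _).trans (by simp)

theorem runs_fetch {a i dst : Stack} {s : WState} {L : List ℕ} {n x : ℕ} (hx : L[n]? = some x)
    (ha : s.stk a = letters L) (hi : s.stk i = List.replicate n Γ'.blank)
    (htmp : s.stk .tmp = []) (hsel : s.stk .sel = []) (hdst : s.stk dst = []) (hBN : B ≤ N)
    (hL : (letters L).length ≤ B) (hn : n + 1 ≤ B)
    (ha1 : a ≠ .tmp) (ha2 : a ≠ .sel) (ha3 : a ≠ dst) (hi1 : i ≠ .tmp) (hi2 : i ≠ .sel)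
    (hd1 : dst ≠ .tmp) (hd2 : dst ≠ .sel) :
    Runs B N (fetch a i dst) s ⟨{ s.var with cur := none, hit := false },
      Function.update s.stk dst ((Nat.bits x).map Γ'.bit).reverse⟩ := by
  set m := List.replicate n Γ'.blank ++ [Γ'.ket] with hm
  let F := fun p : List Γ' => p.foldl fetchStep (m, [])
  -- The top of the list of marks has already been popped: the memory bit `hit` tells whether it is
  -- `ket`, and `sel` holds only the tail.
  let st : List Γ' → List Γ' → WState := fun p q =>
    ⟨{ s.var with cur := p.getLast?, hit := decide ((F p).1.head? = some Γ'.ket) },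
      fun j => if j = a then q else if j = .tmp then p.reverse else if j = dst then (F p).2
        else if j = .sel then (F p).1.tail else s.stk j⟩
  have hloop := runs_forUntil (B := B) (N := N) (k := a) (halts := fun _ => false)
    (body := pushCur .tmp ;; .ite (fun v => v.cur = some Γ'.comma) tick
      (.ite (fun v => v.hit) (pushCur dst) skip)) (letters L) st (hL.trans hBN) ?_ (by simp [st])
  · refine (runs_pushSym Γ'.ket (by rw [hsel]; simp; omega)).seq ?_
    refine (runs_copy (by simp [htmp]) (by simp [hi2, hi]; omega) (by simp [hi2, hi, hsel]; omega)
      hi2 hi1).seq ?_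
    refine Runs.seq (t := st [] (letters L)) ?_ (hloop.seq ?_)
    · change _ = _
      simp only [st, F, hm, hsel, hi, List.foldl_nil, Function.update_self, List.getLast?_nil,
        Function.update_of_ne hi2]
      congr 1
      funext j
      by_cases h1 : j = .sel
      · subst h1; simp [ha2.symm, hd2.symm]
      · by_cases h2 : j = a
        · subst h2; simp [h1, ha]
        · by_cases h3 : j = .tmp
          · subst h3; simp [h2, htmp]
          · by_cases h4 : j = dst
            · subst h4; simp [h1, h2, h3, hdst]
            · simp [h1, h2, h3, h4]
    · have hF : F (letters L) = ([], ((Nat.bits x).map Γ'.bit).reverse) := foldl_fetchStep L n x hx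
      refine (runs_move (letters L).reverse [] (by simp [st, ha1.symm]) (by simp) (by simp)
        (by simpa using hL.trans hBN) (by simpa [st] using hL) (by simp)
        (by simpa using ha1.symm)).congr ?_
      simp only [st, hF]
      congr 1
      funext j
      by_cases h3 : j = .tmp
      · subst h3; simp [hd1.symm, htmp]
      · by_cases h2 : j = a
        · subst h2; simp [ha3, h3, ha]
        · by_cases h4 : j = dst
          · subst h4; simp [h2, h3]
          · by_cases h1 : j = .sel
            · subst h1; simp [h2, h3, h4, hsel]
            · simp [h1, h2, h3, h4]
  · intro p c q hq
    refine ⟨⟨c, by simp [st], rfl⟩, ?_⟩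
    have hlen : p.length + 1 ≤ B := by
      have := congrArg List.length hq
      simp at this
      omega
    have hdl : (F p).2.length ≤ p.length := by simpa using length_foldl_fetchStep p m []
    have hF : F (p ++ [c]) = fetchStep (F p) c := by simp [F, List.foldl_append]
    refine (runs_pushCur (c := c) (by simp [popped, st]) ?_).seq ?_
    · simpa [popped, st, ha1.symm] using hlen
    · by_cases hc : c = Γ'.comma
      · refine Runs.ite_true (by simp [popped, st, hc]) ?_
        change _ = _
        have hF' : F (p ++ [c]) = ((F p).1.tail, (F p).2) := by rw [hF, fetchStep, if_pos hc]
        simp only [popped, st, hF']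
        congr 1
        · simp [ha2.symm, hd2.symm]
        · funext j
          by_cases h1 : j = .sel
          · subst h1; simp [ha2.symm, hd2.symm]
          · by_cases h3 : j = .tmp
            · subst h3; simp [ha1.symm]
            · by_cases h2 : j = a
              · subst h2; simp [h1, h3]
              · simp [h1, h2, h3]
      · refine Runs.ite_false (by simp [popped, st, hc]) ?_
        by_cases hh : (F p).1.head? = some Γ'.ket
        · refine Runs.ite_true (by simp [popped, st, hh]) ?_
          refine (runs_pushCur (c := c) (by simp [popped, st]) ?_).congr ?_
          · simp [popped, st, ha3.symm, hd1]; omega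
          · simp only [popped, st, hF, fetchStep, hc, hh, if_true, if_false]
            congr 1
            · simp
            · funext j
              by_cases h4 : j = dst
              · subst h4; simp [ha3.symm, hd1]
              · by_cases h3 : j = .tmp
                · subst h3; simp [ha1.symm, h4]
                · by_cases h2 : j = a
                  · subst h2; simp [h4, h3]
                  · simp [h4, h2, h3]
        · refine Runs.ite_false (by simp [popped, st, hh]) ?_
          refine (runs_skip _).congr ?_
          simp only [popped, st, hF, fetchStep, hc, hh, if_false]
          congr 1
          · simp
          · funext j
            by_cases h3 : j = .tmp
            · subst h3; simp [ha1.symm]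
            · by_cases h2 : j = a
              · subst h2; simp [h3]
              · simp [h2, h3]

/-- This is the invariant of the comparison loop: `eq` records that the symbols read so far form a
prefix of the second stack. -/
theorem decide_prefix_snoc (p l : List Γ') (c : Γ') :
    (decide (p = l.take p.length) && decide ((l.drop p.length).head? = some c)) =
      decide (p ++ [c] = l.take (p ++ [c]).length) := by
  induction p generalizing l with
  | nil =>
    cases l with
    | nil => simp
    | cons b l => simp [eq_comm]
  | cons a p ih =>
    cases l with
    | nil => simp
    | cons b l =>
      have := ih l
      simp only [List.length_cons, List.take_succ_cons, List.cons.injEq, List.drop_succ_cons,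
        List.cons_append, Bool.decide_and, Bool.and_assoc] at this ⊢
      rw [this]

theorem decide_prefix_end (p l : List Γ') :
    (decide (p = l.take p.length) && (l.drop p.length).head?.isNone) = decide (p = l) := by
  induction p generalizing l with
  | nil => cases l <;> simp
  | cons a p ih =>
    cases l with
    | nil => simp
    | cons b l =>
      have := ih l
      simp only [List.length_cons, List.take_succ_cons, List.cons.injEq, List.drop_succ_cons,
        Bool.decide_and, Bool.and_assoc] at this ⊢
      rw [this]

/-- Compare the contents of the stacks `fst` and `snd`, and empty them. -/
def compare : WProg :=
  .load (fun v => { v with eq := true }) ;;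
  forEach .fst (.pop .snd fun v o => { v with eq := v.eq && decide (o = v.cur) }) ;;
  .pop .snd (fun v o => { v with eq := v.eq && o.isNone }) ;;
  clear .snd

theorem runs_compare {s : WState} (h1 : (s.stk .fst).length ≤ N) (h2 : (s.stk .snd).length ≤ N) :
    Runs B N compare s ⟨{ s.var with cur := none, eq := decide (s.stk .fst = s.stk .snd) },
      Function.update (Function.update s.stk .fst []) .snd []⟩ := by
  let st : List Γ' → List Γ' → WState := fun p q =>
    ⟨{ s.var with cur := if p = [] then s.var.cur else p.getLast?,
                  eq := decide (p = (s.stk .snd).take p.length) },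
      Function.update (Function.update s.stk .fst q) .snd ((s.stk .snd).drop p.length)⟩
  have hloop := runs_forUntil (B := B) (N := N) (k := .fst) (halts := fun _ => false)
    (body := .pop .snd fun v o => { v with eq := v.eq && decide (o = v.cur) }) (s.stk .fst) st h1
    ?_ (by simp [st])
  · refine Runs.seq (t := st [] (s.stk .fst)) ((runs_load _ _).congr ?_)
      (hloop.seq ((runs_pop _ _ _).seq ((runs_clear ?_).congr ?_)))
    · simp [st]
    · simp [st]; omega
    · simp only [st]
      congr 1
      · simp only [Function.update_self, ne_eq, reduceCtorEq, not_false_eq_true,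
          Function.update_of_ne, decide_prefix_end]
      · funext j
        by_cases h : j = .snd
        · subst h; simp
        · by_cases h' : j = .fst
          · subst h'; simp
          · simp [h, h']
  · intro p c q hq
    refine ⟨⟨c, by simp [st], rfl⟩, ?_⟩
    change _ = _
    simp only [popped, st]
    congr 1
    · rw [← decide_prefix_snoc]
      simp
    · funext j
      by_cases h : j = .snd
      · subst h; simp
      · by_cases h' : j = .fst
        · subst h'; simp
        · simp [h, h']

/-- A number is determined by its binary digits. -/
theorem bits_injective : Function.Injective Nat.bits := by
  intro m n h
  have key : ∀ n : ℕ, (Nat.bits n).foldr (fun b k => Nat.bit b k) 0 = n := by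
    intro n
    induction n using Nat.binaryRec' with
    | zero => simp
    | bit b n hb ih => rw [Nat.bits_append_bit _ _ hb, List.foldr_cons, ih]
  rw [← key m, h, key]

/-- Compare the letter of the word in `a` at the position in `i` with the letter of the word in `b`
at the position in `j`. -/
def eqAt (a i b j : Stack) : WProg :=
  fetch a i .fst ;; fetch b j .snd ;; compare

theorem runs_eqAt {a i b j : Stack} {s : WState} {L L' : List ℕ} {n n' x x' : ℕ}
    (hx : L[n]? = some x) (hx' : L'[n']? = some x')
    (ha : s.stk a = letters L) (hi : s.stk i = List.replicate n Γ'.blank)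
    (hb : s.stk b = letters L') (hj : s.stk j = List.replicate n' Γ'.blank)
    (htmp : s.stk .tmp = []) (hsel : s.stk .sel = []) (hfst : s.stk .fst = [])
    (hsnd : s.stk .snd = []) (hBN : B ≤ N) (hL : (letters L).length ≤ B)
    (hL' : (letters L').length ≤ B) (hn : n + 1 ≤ B) (hn' : n' + 1 ≤ B)
    (ha' : a ∉ [Stack.tmp, .sel, .fst, .snd] := by decide)
    (hi' : i ∉ [Stack.tmp, .sel, .fst, .snd] := by decide)
    (hb' : b ∉ [Stack.tmp, .sel, .fst, .snd] := by decide)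
    (hj' : j ∉ [Stack.tmp, .sel, .fst, .snd] := by decide) :
    Runs B N (eqAt a i b j) s
      ⟨{ s.var with cur := none, hit := false, eq := decide (x = x') }, s.stk⟩ := by
  simp only [List.mem_cons, List.not_mem_nil, or_false, not_or] at ha' hi' hb' hj'
  have hlen : ∀ {L : List ℕ} {n x : ℕ}, L[n]? = some x → (letters L).length ≤ B →
      ((Nat.bits x).map Γ'.bit).reverse.length ≤ N := by
    intro L n x hx hL
    have := length_foldl_fetchStep (letters L) (List.replicate n Γ'.blank ++ [Γ'.ket]) []
    rw [foldl_fetchStep L n x hx] at this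
    simp only [List.length_nil, add_zero] at this
    omega
  refine (runs_fetch hx ha hi htmp hsel hfst hBN hL hn ha'.1 ha'.2.1 ha'.2.2.1 hi'.1 hi'.2.1
    (by decide) (by decide)).seq ?_
  refine (runs_fetch hx' (by simpa [hb'.2.2.1] using hb) (by simpa [hj'.2.2.1] using hj)
    (by simpa using htmp) (by simpa using hsel) (by simpa using hsnd) hBN hL' hn' hb'.1 hb'.2.1
    hb'.2.2.2 hj'.1 hj'.2.1 (by decide) (by decide)).seq ?_
  refine (runs_compare (by simpa using hlen hx hL) (by simpa using hlen hx' hL')).congr ?_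
  congr 1
  -- Both letters were fetched with reversed digits, which does not affect equality.
  · simp [List.map_inj_right, bits_injective.eq_iff]
  · funext k
    by_cases h : k = .snd
    · subst h; simp [hsnd]
    · by_cases h' : k = .fst
      · subst h'; simp [hfst]
      · simp [h, h']


/-! ### Computing one digit of a response. -/

open WordleInstance (encodeNumber response)

variable {B N : ℕ}

/-- Run `act` if the letters in `a` at `i` and in `b` at `j` agree, but those in `a'` at `i'` and in
`b'` at `j'` do not. -/
def guarded (a i b j a' i' b' j' : Stack) (act : WProg) : WProg :=
  eqAt a i b j ;;
  .ite (fun v => v.eq) (eqAt a' i' b' j' ;; .ite (fun v => v.eq) skip act) skip ;;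
  .load (fun v => { v with eq := false })

/-- The stacks that comparisons of letters use for intermediate results are empty. -/
structure Scratch (f : Stack → List Γ') : Prop where
  tmp : f .tmp = []
  sel : f .sel = []
  fst : f .fst = []
  snd : f .snd = []

/-- The word `L` is written on the stack `l`, and obeys the length bound `B`. -/
structure IsWord (B : ℕ) (l : List Γ') (L : List ℕ) : Prop where
  eq : l = letters L
  le : l.length ≤ B

/-- The number `n` is written on the stack `l` in unary, and obeys the bound `B`. -/
structure IsMarks (B : ℕ) (l : List Γ') (n : ℕ) : Prop where
  eq : l = List.replicate n Γ'.blank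
  lt : n < B

theorem runs_eqAt' {a i b j : Stack} {s : WState} {L L' : List ℕ} {n n' : ℕ}
    (hx : n < L.length) (hx' : n' < L'.length)
    (ha : IsWord B (s.stk a) L) (hi : IsMarks B (s.stk i) n)
    (hb : IsWord B (s.stk b) L') (hj : IsMarks B (s.stk j) n')
    (hs : Scratch s.stk) (hBN : B ≤ N)
    (ha' : a ∉ [Stack.tmp, .sel, .fst, .snd])
    (hi' : i ∉ [Stack.tmp, .sel, .fst, .snd])
    (hb' : b ∉ [Stack.tmp, .sel, .fst, .snd])
    (hj' : j ∉ [Stack.tmp, .sel, .fst, .snd]) :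
    Runs B N (eqAt a i b j) s
      ⟨{ s.var with cur := none, hit := false, eq := decide (L[n]? = L'[n']?) }, s.stk⟩ := by
  refine (runs_eqAt (List.getElem?_eq_getElem hx) (List.getElem?_eq_getElem hx') ha.eq hi.eq hb.eq
    hj.eq hs.tmp hs.sel hs.fst hs.snd hBN (ha.eq ▸ ha.le) (hb.eq ▸ hb.le) hi.lt hj.lt
    ha' hi' hb' hj').congr ?_
  simp [List.getElem?_eq_getElem hx, List.getElem?_eq_getElem hx']

/-- The result `t` is prescribed by the caller. Both outcomes leave `eq` and thus the memory in a
uniform form, as a loop invariant needs. -/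
theorem runs_guarded {a i b j a' i' b' j' : Stack} {act : WProg} {s t : WState}
    {L M L' M' : List ℕ} {n k n' k' : ℕ}
    (hn : n < L.length) (hk : k < M.length) (hn' : n' < L'.length) (hk' : k' < M'.length)
    (ha : IsWord B (s.stk a) L) (hi : IsMarks B (s.stk i) n)
    (hb : IsWord B (s.stk b) M) (hj : IsMarks B (s.stk j) k)
    (ha' : IsWord B (s.stk a') L') (hi' : IsMarks B (s.stk i') n')
    (hb' : IsWord B (s.stk b') M') (hj' : IsMarks B (s.stk j') k')
    (hs : Scratch s.stk) (hBN : B ≤ N)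
    (hact : L[n]? = M[k]? ∧ L'[n']? ≠ M'[k']? →
      Runs B N act ⟨{ s.var with cur := none, hit := false, eq := false }, s.stk⟩ t ∧
        t.var.eq = false)
    (hskip : ¬ (L[n]? = M[k]? ∧ L'[n']? ≠ M'[k']?) →
      t = ⟨{ s.var with cur := none, hit := false, eq := false }, s.stk⟩)
    (h1 : a ∉ [Stack.tmp, .sel, .fst, .snd] := by decide)
    (h2 : i ∉ [Stack.tmp, .sel, .fst, .snd] := by decide)
    (h3 : b ∉ [Stack.tmp, .sel, .fst, .snd] := by decide)
    (h4 : j ∉ [Stack.tmp, .sel, .fst, .snd] := by decide)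
    (h5 : a' ∉ [Stack.tmp, .sel, .fst, .snd] := by decide)
    (h6 : i' ∉ [Stack.tmp, .sel, .fst, .snd] := by decide)
    (h7 : b' ∉ [Stack.tmp, .sel, .fst, .snd] := by decide)
    (h8 : j' ∉ [Stack.tmp, .sel, .fst, .snd] := by decide) :
    Runs B N (guarded a i b j a' i' b' j' act) s t := by
  refine (runs_eqAt' hn hk ha hi hb hj hs hBN h1 h2 h3 h4).seq ?_
  by_cases e1 : L[n]? = M[k]?
  · refine Runs.seq (t := if L'[n']? = M'[k']? then
        ⟨{ s.var with cur := none, hit := false, eq := true }, s.stk⟩ else t) ?_ ?_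
    · refine Runs.ite_true (by simp [e1]) ?_
      have h := runs_eqAt' (s := ⟨{ s.var with cur := none, hit := false, eq := true }, s.stk⟩)
        hn' hk' ha' hi' hb' hj' hs hBN h5 h6 h7 h8
      rw [decide_eq_true e1]
      refine h.seq ?_
      clear h
      by_cases e2 : L'[n']? = M'[k']?
      · refine Runs.ite_true (by simp [e2]) ((runs_skip _).congr ?_)
        simp [e2]
      · refine Runs.ite_false (by simp [e2]) ?_
        simpa [e2] using (hact ⟨e1, e2⟩).1
    · refine (runs_load _ _).congr ?_
      by_cases e2 : L'[n']? = M'[k']?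
      · simp [e2, hskip]
      · have := (hact ⟨e1, e2⟩).2
        simp only [e2, if_false]
        cases t with | mk v f => cases v; simp_all
  · refine Runs.seq (Runs.ite_false (by simp [e1]) (runs_skip _)) ((runs_load _ _).congr ?_)
    simp [hskip (fun h => e1 h.1)]

/-- Compute the response to the query in `qry` for the target in `a`, at the position in `idx`. -/
def respAt (a : Stack) : WProg :=
  eqAt a .idx .qry .idx ;;
  .ite (fun v => v.eq) (.load fun v => { v with resp := 2 })
    (copy .len .pos ;;
      .load (fun v => { v with eq := false, hit := false }) ;;
      forEach .pos (guarded a .pos .qry .idx a .pos .qry .pos (pushSym .cnt Γ'.blank)) ;;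
      copy .idx .pos ;; pushSym .pos Γ'.blank ;; .load (fun v => { v with ok := true }) ;;
      forEach .pos (guarded .qry .pos .qry .idx .qry .pos a .pos
        (.pop .cnt fun v o => { v with ok := v.ok && o.isSome })) ;;
      clear .cnt ;; .load fun v => { v with resp := if v.ok then 1 else 0 }) ;;
  .load fun v => { v with eq := false, ok := false }

/-- The number of `j` with `m ≤ j < n` such that `P j`. -/
def countFrom (P : ℕ → Prop) [DecidablePred P] (m n : ℕ) : ℕ :=
  ∑ j ∈ Finset.Ico m n, if P j then 1 else 0

theorem countFrom_self (P : ℕ → Prop) [DecidablePred P] (n : ℕ) : countFrom P n n = 0 := by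
  simp [countFrom]

theorem countFrom_step (P : ℕ → Prop) [DecidablePred P] {m n : ℕ} (h : m < n) :
    countFrom P m n = countFrom P (m + 1) n + if P m then 1 else 0 := by
  rw [countFrom, Finset.sum_eq_sum_Ico_succ_bot h, add_comm]; rfl

theorem countFrom_le (P : ℕ → Prop) [DecidablePred P] (m n : ℕ) : countFrom P m n ≤ n - m := by
  refine (Finset.sum_le_card_nsmul _ _ 1 fun j _ => ?_).trans (by simp)
  split_ifs <;> simp

theorem card_filter_eq_countFrom {d : ℕ} (P : ℕ → Prop) [DecidablePred P] (Q : Fin d → Prop)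
    [DecidablePred Q] {n : ℕ} (hn : n ≤ d) (h : ∀ j : Fin d, Q j ↔ (j : ℕ) < n ∧ P j) :
    (Finset.univ.filter Q).card = countFrom P 0 n := by
  rw [Finset.card_filter, Finset.sum_congr rfl (fun j _ => by rw [if_congr (h j) rfl rfl]),
    Fin.sum_univ_eq_sum_range (fun j => if j < n ∧ P j then 1 else 0) d, countFrom,
    Finset.range_eq_Ico, ← Finset.sum_subset (Finset.Ico_subset_Ico_right hn)]
  · refine Finset.sum_congr rfl fun j hj => ?_
    simp [(Finset.mem_Ico.1 hj).2]
  · intro j _ hj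
    rw [if_neg]
    simp only [Finset.mem_Ico, Nat.zero_le, true_and] at hj
    exact fun h => hj h.1

variable {α : Type} {d : ℕ}

/-- The numbers of the letters of a word. -/
def nums (num : α → ℕ) (u : Fin d → α) : List ℕ := (List.ofFn u).map num

theorem length_nums (num : α → ℕ) (u : Fin d → α) : (nums num u).length = d := by simp [nums]

theorem nums_getElem? (num : α → ℕ) (u : Fin d → α) (i : Fin d) :
    (nums num u)[(i : ℕ)]? = some (num (u i)) := by
  simp [nums]

/-- The machine sees only the numbers of letters, and its loops run through positions as natural
numbers from the top down. Injectivity of the numbering makes the two descriptions agree. -/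
theorem response_eq_countFrom [DecidableEq α] {num : α → ℕ} (hnum : Function.Injective num)
    (w u : Fin d → α) (i : Fin d) :
    response w u i = if (nums num w)[(i : ℕ)]? = (nums num u)[(i : ℕ)]? then 2 else
      if countFrom (fun j : ℕ => (nums num u)[j]? = (nums num u)[(i : ℕ)]? ∧
          (nums num u)[j]? ≠ (nums num w)[j]?) 0 (i + 1) ≤
        countFrom (fun j : ℕ => (nums num w)[j]? = (nums num u)[(i : ℕ)]? ∧
          (nums num w)[j]? ≠ (nums num u)[j]?) 0 d then 1 else 0 := by
  unfold response
  rw [← card_filter_eq_countFrom _ (fun j : Fin d => j ≤ i ∧ u i = u j ∧ u j ≠ w j) i.2,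
    ← card_filter_eq_countFrom _ (fun j : Fin d => w j = u i ∧ w j ≠ u j) le_rfl]
  · simp [nums_getElem?, hnum.eq_iff]
  · intro j
    simp [nums_getElem?, hnum.eq_iff]
  · intro j
    simp only [nums_getElem?, Option.some.injEq, hnum.eq_iff, ne_eq, Fin.le_def, Nat.lt_succ_iff]
    rw [eq_comm (a := u i)]

theorem runs_respAt [DecidableEq α] {num : α → ℕ} (hnum : Function.Injective num) {a : Stack}
    {s : WState} {w u : Fin d → α} (i : Fin d)
    (ha : IsWord B (s.stk a) (nums num w)) (hq : IsWord B (s.stk .qry) (nums num u))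
    (hi : IsMarks B (s.stk .idx) i) (hlen : IsMarks B (s.stk .len) d) (hs : Scratch s.stk)
    (hpos : s.stk .pos = []) (hcnt : s.stk .cnt = []) (hBN : B ≤ N)
    (ha' : a = .tgt ∨ a = .old) :
    Runs B N (respAt a) s ⟨{ s.var with
      cur := none, hit := false, eq := false, ok := false, resp := response w u i }, s.stk⟩ := by
  have ha1 : a ∉ [Stack.tmp, .sel, .fst, .snd] := by rcases ha' with rfl | rfl <;> decide
  have ha2 : a ≠ .pos ∧ a ≠ .cnt := by rcases ha' with rfl | rfl <;> decide
  have hw : ∀ n < d, n < (nums num w).length := fun n hn => by rwa [length_nums]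
  have hu : ∀ n < d, n < (nums num u).length := fun n hn => by rwa [length_nums]
  have hdB := hlen.lt
  rw [response_eq_countFrom hnum]
  refine (runs_eqAt' (hw i i.2) (hu i i.2) ha hi hq hi hs hBN ha1 (by decide) (by decide)
    (by decide)).seq ?_
  by_cases e : (nums num w)[(i : ℕ)]? = (nums num u)[(i : ℕ)]?
  · refine Runs.seq (Runs.ite_true (by simp [e]) (runs_load _ _)) ((runs_load _ _).congr ?_)
    simp [e]
  simp only [if_neg e]
  set P := fun j : ℕ => (nums num w)[j]? = (nums num u)[(i : ℕ)]? ∧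
          (nums num w)[j]? ≠ (nums num u)[j]? with hP
  set Q := fun j : ℕ => (nums num u)[j]? = (nums num u)[(i : ℕ)]? ∧
          (nums num u)[j]? ≠ (nums num w)[j]? with hQ
  let v : Mem := { s.var with cur := none, hit := false, eq := false }
  let f : ℕ → ℕ → Stack → List Γ' := fun m c =>
    Function.update (Function.update s.stk .pos (List.replicate m Γ'.blank)) .cnt
      (List.replicate c Γ'.blank)
  have hf1 : ∀ m c k, k ≠ .pos → k ≠ .cnt → f m c k = s.stk k := fun m c k h h' => by
    simp [f, h, h']
  have hf2 : ∀ m c, f m c .pos = List.replicate m Γ'.blank := fun m c => by simp [f]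
  have hf3 : ∀ m c, f m c .cnt = List.replicate c Γ'.blank := fun m c => by simp [f]
  have hfS : ∀ m c, Scratch (f m c) := fun m c =>
    ⟨by simp [f, hs.tmp], by simp [f, hs.sel], by simp [f, hs.fst], by simp [f, hs.snd]⟩
  have hfa : ∀ m c, IsWord B (f m c a) (nums num w) := fun m c => by
    rw [hf1 m c a ha2.1 ha2.2]; exact ha
  have hfq : ∀ m c, IsWord B (f m c .qry) (nums num u) := fun m c => by
    rw [hf1 m c .qry (by decide) (by decide)]; exact hq
  have hfi : ∀ m c, IsMarks B (f m c .idx) i := fun m c => by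
    rw [hf1 m c .idx (by decide) (by decide)]; exact hi
  have hfi' : ∀ m c, f m c .idx = List.replicate i Γ'.blank := fun m c => (hfi m c).eq
  have hfp : ∀ m c, m < d → IsMarks B (f m c .pos) m := fun m c h => ⟨hf2 m c, by omega⟩
  have hfu : ∀ m m' c, Function.update (f m c) .pos (List.replicate m' Γ'.blank) = f m' c := by
    intro m m' c
    simp only [f]
    rw [Function.update_comm (by decide), Function.update_idem]
  have hfc : ∀ m c c', Function.update (f m c) .cnt (List.replicate c' Γ'.blank) = f m c' := by
    intro m c c'
    simp only [f]
    rw [Function.update_idem]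
  have hf0 : f 0 0 = s.stk := by
    funext k
    by_cases h : k = .cnt
    · subst h; simp [f, hcnt]
    · by_cases h' : k = .pos
      · subst h'; simp [f, hpos]
      · exact hf1 _ _ _ h' h
  -- The marks left on `pos` are the position under test in unary. The positions from `m` to `d - 1`
  -- have been treated, and `cnt` holds one mark for each that satisfies `P`.
  have loop1 := runs_forMarks (B := B) (N := N) (k := .pos)
    (body := guarded a .pos .qry .idx a .pos .qry .pos (pushSym .cnt Γ'.blank)) d
    (fun m => ⟨v, f m (countFrom P m d)⟩) (by omega) (fun m _ => hf2 m (countFrom P m d)) ?_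
  -- Each position up to `i` with `Q` cancels one mark of `cnt`. The inequality between the counts
  -- holds iff no pop meets an empty stack; truncated subtraction describes the marks left in either
  -- case.
  · have loop2 := runs_forMarks (B := B) (N := N) (k := .pos)
      (body := guarded .qry .pos .qry .idx .qry .pos a .pos
        (.pop .cnt fun v o => { v with ok := v.ok && o.isSome })) (i + 1)
      (fun m => ⟨{ v with ok := decide (countFrom Q m (i + 1) ≤ countFrom P 0 d) },
        f m (countFrom P 0 d - countFrom Q m (i + 1))⟩) (by omega)
      (fun m _ => hf2 m (countFrom P 0 d - countFrom Q m (i + 1))) ?_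
    · refine Runs.seq (t := ⟨{ v with
          ok := decide (countFrom Q 0 (i + 1) ≤ countFrom P 0 d),
          resp := if countFrom Q 0 (i + 1) ≤ countFrom P 0 d then 1 else 0 }, s.stk⟩)
        (Runs.ite_false (by simp [e]) ?_) rfl
      refine Runs.seq (runs_copy hs.tmp (by simp [hlen.eq]; omega)
        (by simp [hlen.eq, hpos]; omega)) ?_
      refine Runs.seq (t := ⟨v, f d (countFrom P d d)⟩) ((runs_load _ _).congr ?_) (loop1.seq ?_)
      · simp only [countFrom_self, hlen.eq, hpos, List.append_nil, v]
        rw [← hfu 0, hf0]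
      refine Runs.seq (runs_copy (hfS 0 (countFrom P 0 d)).tmp (by simp [hfi']; omega)
        (by simp [hfi', hf2]; omega)) ?_
      refine Runs.seq (runs_pushSym _ (by simp [hfi', hf2]; omega)) ?_
      refine Runs.seq (t := ⟨{ v with ok := decide (countFrom Q (i + 1) (i + 1) ≤ countFrom P 0 d) },
        f (i + 1) (countFrom P 0 d - countFrom Q (i + 1) (i + 1))⟩) ((runs_load _ _).congr ?_)
        (loop2.seq ?_)
      · simp only [countFrom_self, hf2, hfi', List.replicate_zero, List.append_nil,
          Function.update_self, Nat.sub_zero, ← List.replicate_succ, hfu]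
        simp [v]
      refine Runs.seq (runs_clear (by
        have := countFrom_le P 0 d
        simp [hf3]; omega)) ((runs_load _ _).congr ?_)
      have := hfc 0 (countFrom P 0 d - countFrom Q 0 (i + 1)) 0
      rw [List.replicate_zero] at this
      simp [this, hf0, v]
    · intro m hm
      simp only [hfu]
      have hmd : m < d := by omega
      let c := countFrom P 0 d - countFrom Q (m + 1) (i + 1)
      refine runs_guarded (hu m hmd) (hu i i.2) (hu m hmd) (hw m hmd) (hfq m c) (hfp m c hmd)
        (hfq m c) (hfi m c) (hfq m c) (hfp m c hmd) (hfa m c) (hfp m c hmd) (hfS m c) hBN ?_ ?_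
        (h7 := ha1)
      · intro hc
        refine ⟨(runs_pop _ _ _).congr ?_, rfl⟩
        rw [countFrom_step Q hm, if_pos hc]
        simp only [hf3]
        congr 1
        · simp only [v, Mem.mk.injEq, and_true, true_and]
          -- The pop succeeds iff this difference is positive, that is, iff one more `Q` can still
          -- be matched.
          rcases h : countFrom P 0 d - countFrom Q (m + 1) (i + 1) with _ | n
          · simp; omega
          · simp [List.replicate_succ]
            omega
        · rw [List.tail_replicate, hfc]
          congr 1
      · intro hc
        rw [countFrom_step Q hm, if_neg hc]
        rfl
  · intro m hm
    simp only [hfu]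
    let c := countFrom P (m + 1) d
    refine runs_guarded (hw m hm) (hu i i.2) (hw m hm) (hu m hm) (hfa m c) (hfp m c hm)
        (hfq m c) (hfi m c) (hfa m c) (hfp m c hm) (hfq m c) (hfp m c hm) (hfS m c) hBN ?_ ?_
        (h1 := ha1) (h5 := ha1)
    · intro hc
      have := countFrom_le P (m + 1) d
      refine ⟨(runs_pushSym _ (by simp [hf3]; omega)).congr ?_, rfl⟩
      rw [countFrom_step P hm, if_pos hc]
      simp only [hf3, ← List.replicate_succ, hfc]
      rfl
    · intro hc
      rw [countFrom_step P hm, if_neg hc]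
      rfl


/-! ### Testing a word against one recorded round. -/

open WordleInstance (encodeNumber response)

variable {B N : ℕ}

/-- Note in `agree` whether the query in `qry` gets the same response from the words in `tgt` and
`old`, and is not the word in `tgt`. -/
def checkPair : WProg :=
  copy .len .idx ;;
  forEach .idx (respAt .tgt ;; .load (fun v => { v with prev := v.resp }) ;; respAt .old ;;
    .load (fun v => { v with
      agree := v.agree && decide (v.resp = v.prev), differ := v.differ || decide (v.prev ≠ 2),
      resp := 0, prev := 0 })) ;;
  .load fun v => { v with agree := v.agree && v.differ, differ := false }

/-- The memory outside of the evaluation of a position. -/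
def mem (agree par up val done : Bool) : Mem where
  cur := none
  bit := false
  hit := false
  eq := false
  ok := false
  agree := agree
  differ := false
  resp := 0
  prev := 0
  par := par
  up := up
  val := val
  done := done

variable {α : Type} {d : ℕ}

theorem runs_checkPair [DecidableEq α] {num : α → ℕ} (hnum : Function.Injective num)
    {agree par up val done : Bool} {f : Stack → List Γ'} {w w' u : Fin d → α}
    (ht : IsWord B (f .tgt) (nums num w)) (ho : IsWord B (f .old) (nums num w'))
    (hq : IsWord B (f .qry) (nums num u)) (hlen : IsMarks B (f .len) d) (hs : Scratch f)
    (hidx : f .idx = []) (hpos : f .pos = []) (hcnt : f .cnt = []) (hBN : B ≤ N) :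
    Runs B N checkPair ⟨mem agree par up val done, f⟩
      ⟨mem (agree && decide (response w u = response w' u ∧ w ≠ u)) par up val done, f⟩ := by
  have hdB := hlen.lt
  let st : ℕ → WState := fun m => ⟨{ mem
      (agree && decide (∀ j : Fin d, m ≤ j → response w u j = response w' u j))
      par up val done with differ := decide (∃ j : Fin d, m ≤ j ∧ w j ≠ u j) },
    Function.update f .idx (List.replicate m Γ'.blank)⟩
  have hloop := runs_forMarks (B := B) (N := N) (k := .idx)
    (body := respAt .tgt ;; .load (fun v => { v with prev := v.resp }) ;; respAt .old ;;
    .load (fun v => { v with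
      agree := v.agree && decide (v.resp = v.prev), differ := v.differ || decide (v.prev ≠ 2),
      resp := 0, prev := 0 })) d st (by omega) (fun m _ => by simp [st]) ?_
  · refine Runs.seq (t := st d) ((runs_copy hs.tmp (by simp [hlen.eq]; omega)
      (by simp [hlen.eq, hidx]; omega)).congr ?_) (hloop.seq ((runs_load _ _).congr ?_))
    · have h1 : ∀ j : Fin d, ¬ d ≤ j := fun j => by have := j.2; omega
      simp [st, mem, hidx, hlen.eq, h1]
    · have h1 : Function.update f .idx [] = f := by
        rw [Function.update_eq_self_iff, hidx]
      simp [st, mem, h1, funext_iff, Bool.and_assoc]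
  · intro m hm
    let i : Fin d := ⟨m, hm⟩
    simp only [st, Function.update_idem]
    have hsc : Scratch (Function.update f .idx (List.replicate m Γ'.blank)) :=
      ⟨by simp [hs.tmp], by simp [hs.sel], by simp [hs.fst], by simp [hs.snd]⟩
    refine Runs.seq (runs_respAt hnum i (by simpa using ht) (by simpa using hq)
      ⟨by simp [i], by simp [i]; omega⟩ (by simpa using hlen) hsc (by simpa using hpos)
      (by simpa using hcnt) hBN (.inl rfl)) ?_
    refine Runs.seq (runs_load _ _) ?_
    refine Runs.seq (runs_respAt hnum i (by simpa using ho) (by simpa using hq)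
      ⟨by simp [i], by simp [i]; omega⟩ (by simpa using hlen) hsc (by simpa using hpos)
      (by simpa using hcnt) hBN (.inr rfl)) ((runs_load _ _).congr ?_)
    congr 1
    have e1 : (∀ j : Fin d, m ≤ j → response w u j = response w' u j) ↔
        (∀ j : Fin d, m + 1 ≤ j → response w u j = response w' u j) ∧
          response w' u i = response w u i := by
      constructor
      · exact fun h => ⟨fun j hj => h j (by omega), (h i le_rfl).symm⟩
      · rintro ⟨h, h'⟩ j hj
        rcases hj.eq_or_lt with hj | hj
        · have : j = i := Fin.ext hj.symm
          rw [this, h']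
        · exact h j hj
    -- No separate comparison of `w` with `u` is needed: they differ iff some digit of the response
    -- is not `2`.
    have e2 : (∃ j : Fin d, m ≤ j ∧ w j ≠ u j) ↔
        (∃ j : Fin d, m + 1 ≤ j ∧ w j ≠ u j) ∨ response w u i ≠ 2 := by
      rw [ne_eq (response w u i), WordleInstance.response_eq_two_iff]
      constructor
      · rintro ⟨j, hj, hne⟩
        rcases hj.eq_or_lt with hj | hj
        · have : j = i := Fin.ext hj.symm
          exact .inr (this ▸ hne)
        · exact .inl ⟨j, hj, hne⟩
      · rintro (⟨j, hj, hne⟩ | h)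
        · exact ⟨j, by omega, hne⟩
        · exact ⟨i, le_rfl, h⟩
    simp only [mem, e1, e2, Bool.decide_and, Bool.decide_or, Bool.and_assoc]

/-- The contents of the stacks between the phases of the computation. -/
def cells (dict wrds rem frm aux tgt old qry len : List Γ') : Stack → List Γ'
  | .dict => dict
  | .wrds => wrds
  | .rem => rem
  | .frm => frm
  | .aux => aux
  | .tgt => tgt
  | .old => old
  | .qry => qry
  | .len => len
  | _ => []

section Cells

variable (dict wrds rem frm aux tgt old qry len l : List Γ')

theorem update_cells_rem : Function.update (cells dict wrds rem frm aux tgt old qry len) .rem l =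
    cells dict wrds l frm aux tgt old qry len := by
  funext j; cases j <;> rfl

theorem update_cells_frm : Function.update (cells dict wrds rem frm aux tgt old qry len) .frm l =
    cells dict wrds rem l aux tgt old qry len := by
  funext j; cases j <;> rfl

theorem update_cells_aux : Function.update (cells dict wrds rem frm aux tgt old qry len) .aux l =
    cells dict wrds rem frm l tgt old qry len := by
  funext j; cases j <;> rfl

theorem update_cells_tgt : Function.update (cells dict wrds rem frm aux tgt old qry len) .tgt l =
    cells dict wrds rem frm aux l old qry len := by
  funext j; cases j <;> rfl

theorem update_cells_old : Function.update (cells dict wrds rem frm aux tgt old qry len) .old l =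
    cells dict wrds rem frm aux tgt l qry len := by
  funext j; cases j <;> rfl

theorem update_cells_qry : Function.update (cells dict wrds rem frm aux tgt old qry len) .qry l =
    cells dict wrds rem frm aux tgt old l len := by
  funext j; cases j <;> rfl

theorem update_cells_len : Function.update (cells dict wrds rem frm aux tgt old qry len) .len l =
    cells dict wrds rem frm aux tgt old qry l := by
  funext j; cases j <;> rfl

theorem scratch_cells : Scratch (cells dict wrds rem frm aux tgt old qry len) :=
  ⟨rfl, rfl, rfl, rfl⟩

end Cells

/-- Written words contain no separators, so a scan for a separator stops exactly at the end of a
word or frame. -/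
theorem mem_letters {L : List ℕ} {c : Γ'} (h : c ∈ letters L) : c ≠ Γ'.ket ∧ c ≠ Γ'.blank ∧
    c ≠ Γ'.bra := by
  simp only [letters, encodeNumber, List.mem_flatMap, List.mem_append, List.mem_map,
    List.mem_singleton] at h
  obtain ⟨_, _, ⟨_, _, rfl⟩ | rfl⟩ := h <;> simp

theorem count_comma_letters (L : List ℕ) : (letters L).count Γ'.comma = L.length := by
  induction L with
  | nil => rfl
  | cons x L ih =>
    rw [letters_cons, List.count_append, ih, encodeNumber, List.count_append,
      List.count_eq_zero_of_not_mem]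
    · simp [add_comm]
    · simp

/-- Read the first word of the first frame to the stack `k`. -/
def readHead (k : Stack) : WProg :=
  move .frm (fun c => c = Γ'.ket) [.aux, .tmp] ;; pushSym .aux Γ'.ket ;;
  move .tmp (fun _ => false) [k]

/-- The copy on `aux` is reversed by its single move, ready to be moved back later; the copy on `k`
passes through `tmp` and keeps its order. -/
theorem runs_readHead {k : Stack} {s : WState} {L : List ℕ} {rest : List Γ'}
    (hfrm : s.stk .frm = letters L ++ Γ'.ket :: rest) (htmp : s.stk .tmp = []) (hBN : B ≤ N)
    (haux : (letters L).length + 1 + (s.stk .aux).length ≤ B)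
    (hkB : (letters L).length + (s.stk k).length ≤ B)
    (hk : k = .tgt ∨ k = .old ∨ k = .qry) :
    Runs B N (readHead k) s ⟨{ s.var with cur := none },
      Function.update (Function.update (Function.update s.stk .frm rest) .aux
        (Γ'.ket :: ((letters L).reverse ++ s.stk .aux))) k (letters L ++ s.stk k)⟩ := by
  have hk' : k ≠ .frm ∧ k ≠ .tmp ∧ k ≠ .aux := by rcases hk with rfl | rfl | rfl <;> decide
  refine Runs.seq (runs_move _ _ hfrm (fun c hc => by simpa using (mem_letters hc).1) (by simp)
    (by omega) (by simp [htmp]; omega)) ?_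
  refine Runs.seq (runs_pushSym _ (by simp; omega)) ?_
  refine (runs_move (letters L).reverse [] (by simp [htmp]) (by simp) (by simp)
    (by simp; omega) ?_ (by simp) (by simp [hk'.2.1.symm])).congr ?_
  · simp [hk'.1, hk'.2.1, hk'.2.2]; omega
  · congr 1
    funext j
    by_cases h1 : j = k
    · subst h1; simp [hk'.1, hk'.2.1, hk'.2.2]
    · by_cases h2 : j = .tmp
      · subst h2; simp [h1, htmp]
      · by_cases h3 : j = .aux
        · subst h3; simp [h1]
        · by_cases h4 : j = .frm
          · subst h4; simp [h1]
          · simp [h1, h2, h3, h4]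

/-- Move the rest of the first frame to the stack `aux`. -/
def skipFrame : WProg := move .frm (fun c => c = Γ'.blank) [.aux] ;; pushSym .aux Γ'.blank

theorem runs_skipFrame {s : WState} {l rest : List Γ'}
    (hfrm : s.stk .frm = l ++ Γ'.blank :: rest) (hl : Γ'.blank ∉ l) (hBN : B ≤ N)
    (haux : l.length + 1 + (s.stk .aux).length ≤ B) :
    Runs B N skipFrame s ⟨{ s.var with cur := none },
      Function.update (Function.update s.stk .frm rest) .aux
        (Γ'.blank :: (l.reverse ++ s.stk .aux))⟩ := by
  refine Runs.seq (runs_move _ _ hfrm (fun c hc => by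
    simp only [decide_eq_false_iff_not]; rintro rfl; exact hl hc) (by simp)
    (by omega) (by simp; omega)) ?_
  refine (runs_pushSym _ (by simp; omega)).congr ?_
  congr 1
  funext j
  by_cases h3 : j = .aux
  · subst h3; simp
  · by_cases h4 : j = .frm
    · subst h4; simp
    · simp [h3, h4]


/-! ### Frames of choices, and the check of one round at a leaf. -/

open WordleInstance (encodeNumber response)

variable {B N : ℕ} {α : Type} {d : ℕ}

/-- A list of words, as it is written on a stack: each word is followed by `ket`, and the last one
by `blank`. -/
def frame (num : α → ℕ) (l : List (Fin d → α)) : List Γ' :=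
  l.flatMap (fun u => letters (nums num u) ++ [Γ'.ket]) ++ [Γ'.blank]

theorem frame_nil (num : α → ℕ) : frame num ([] : List (Fin d → α)) = [Γ'.blank] := rfl

theorem frame_cons (num : α → ℕ) (u : Fin d → α) (l : List (Fin d → α)) :
    frame num (u :: l) = letters (nums num u) ++ Γ'.ket :: frame num l := by
  simp [frame]

theorem blank_notMem_words (num : α → ℕ) (l : List (Fin d → α)) :
    Γ'.blank ∉ l.flatMap (fun u => letters (nums num u) ++ [Γ'.ket]) := by
  simp only [List.mem_flatMap, List.mem_append, List.mem_singleton, not_exists, not_and, not_or]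
  exact fun u _ => ⟨fun h => (mem_letters h).2.1 rfl, by simp⟩

/-- Move the first frame to the stack `aux`, and copy its first word to the stack `k`. -/
def readFrame (k : Stack) : WProg := readHead k ;; skipFrame

theorem runs_readFrame {num : α → ℕ} {k : Stack} {s : WState} {w : Fin d → α}
    {l : List (Fin d → α)} {rest : List Γ'}
    (hfrm : s.stk .frm = frame num (w :: l) ++ rest) (htmp : s.stk .tmp = [])
    (hk0 : s.stk k = []) (hBN : B ≤ N)
    (haux : (frame num (w :: l)).length + (s.stk .aux).length ≤ B)
    (hk : k = .tgt ∨ k = .old ∨ k = .qry) :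
    Runs B N (readFrame k) s ⟨{ s.var with cur := none },
      Function.update (Function.update (Function.update s.stk .frm rest) .aux
        ((frame num (w :: l)).reverse ++ s.stk .aux)) k (letters (nums num w))⟩ := by
  have hk' : k ≠ .frm ∧ k ≠ .tmp ∧ k ≠ .aux := by rcases hk with rfl | rfl | rfl <;> decide
  have hlen : (frame num (w :: l)).length = (letters (nums num w)).length + 1 +
      (frame num l).length := by
    rw [frame_cons]; simp; omega
  refine Runs.seq (runs_readHead (L := nums num w) (rest := frame num l ++ rest)
    (by rw [hfrm, frame_cons]; simp) htmp hBN (by omega) (by simp [hk0]; omega) hk) ?_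
  refine (runs_skipFrame (l := l.flatMap fun u => letters (nums num u) ++ [Γ'.ket]) (rest := rest)
    ?_ (blank_notMem_words num l) hBN ?_).congr ?_
  · simp [hk'.1.symm, frame]
  · have : (frame num l).length =
      (l.flatMap fun u => letters (nums num u) ++ [Γ'.ket]).length + 1 := by simp [frame]
    simp only [Function.update_of_ne hk'.2.2.symm, Function.update_self, List.length_cons,
      List.length_append, List.length_reverse]
    omega
  · congr 1
    funext j
    by_cases h1 : j = k
    · subst h1; simp [hk'.1, hk'.2.2, hk0]
    · by_cases h3 : j = .aux
      · subst h3; simp [h1, frame]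
      · by_cases h4 : j = .frm
        · subst h4; simp [h1]
        · simp [h1, h3, h4]

/-- A round of the game as two frames: the word and the query that have been chosen for it, each
with the choices that have still to be tried. -/
abbrev Round (α : Type) (d : ℕ) : Type :=
  ((Fin d → α) × List (Fin d → α)) × ((Fin d → α) × List (Fin d → α))

/-- The frames of a round. -/
def roundStr (num : α → ℕ) (x : Round α d) : List Γ' :=
  frame num (x.1.1 :: x.1.2) ++ frame num (x.2.1 :: x.2.2)

/-- Count the letters of the word in `tgt` in unary in `len`. -/
def countLetters : WProg :=
  move .tgt (fun _ => false) [.tmp] ;;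
  forEach .tmp (pushCur .tgt ;;
    .ite (fun v => v.cur = some Γ'.comma) (pushSym .len Γ'.blank) skip)

/-- The dimension is recovered from the commas of an actual word, so the binary value of `d` in the
input is never expanded. -/
theorem runs_countLetters {s : WState} {L : List ℕ} (htgt : s.stk .tgt = letters L)
    (hlen : s.stk .len = []) (htmp : s.stk .tmp = []) (hBN : B ≤ N)
    (hB : (letters L).length ≤ B) :
    Runs B N countLetters s ⟨{ s.var with cur := none },
      Function.update s.stk .len (List.replicate L.length Γ'.blank)⟩ := by
  let st : List Γ' → List Γ' → WState := fun p q => ⟨{ s.var with cur := p.getLast? },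
    Function.update (Function.update (Function.update s.stk .tmp q) .tgt p.reverse) .len
      (List.replicate (p.count Γ'.comma) Γ'.blank)⟩
  have hloop := runs_forUntil (B := B) (N := N) (k := .tmp) (halts := fun _ => false)
    (body := pushCur .tgt ;; .ite (fun v => v.cur = some Γ'.comma) (pushSym .len Γ'.blank) skip)
    (letters L).reverse st (by simp; omega) ?_ (by simp [st])
  · refine Runs.seq (t := st [] (letters L).reverse) ((runs_move (letters L) [] (by simp [htgt])
      (by simp) (by simp) (by omega) (by simp [htmp]; omega)).congr ?_) (hloop.congr ?_)
    · simp only [st]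
      congr 1
      funext j
      by_cases h1 : j = .len
      · subst h1; simp [hlen]
      · by_cases h2 : j = .tgt
        · subst h2; simp
        · by_cases h3 : j = .tmp
          · subst h3; simp [htmp]
          · simp [h1, h2, h3]
    · simp only [st]
      congr 1
      funext j
      by_cases h1 : j = .len
      · subst h1; simp [count_comma_letters]
      · by_cases h2 : j = .tgt
        · subst h2; simp [htgt]
        · by_cases h3 : j = .tmp
          · subst h3; simp [htmp]
          · simp [h1, h2, h3]
  · intro p c q hq
    refine ⟨⟨c, by simp [st], rfl⟩, ?_⟩
    have hl : p.length + 1 ≤ B := by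
      have := congrArg List.length hq
      simp at this
      omega
    have hc := List.count_le_length (a := Γ'.comma) (l := p)
    refine Runs.seq (runs_pushCur (c := c) (by simp [popped, st])
      (by simp [popped, st]; omega)) ?_
    by_cases hcc : c = Γ'.comma
    · refine Runs.ite_true (by simp [popped, st, hcc]) ((runs_pushSym _ ?_).congr ?_)
      · simp [popped, st]; omega
      · simp only [st, popped]
        congr 1
        · simp
        · funext j
          by_cases h1 : j = .len
          · subst h1; simp [hcc, List.replicate_succ]
          · by_cases h2 : j = .tgt
            · subst h2; simp
            · by_cases h3 : j = .tmp
              · subst h3; simp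
              · simp [h1, h2, h3]
    · refine Runs.ite_false (by simp [popped, st, hcc]) ((runs_skip _).congr ?_)
      simp only [st, popped]
      congr 1
      · simp
      · funext j
        by_cases h1 : j = .len
        · subst h1; simp [hcc]
        · by_cases h2 : j = .tgt
          · subst h2; simp
          · by_cases h3 : j = .tmp
            · subst h3; simp
            · simp [h1, h2, h3]

/-- Evaluate a position in which all choices have been made. -/
def leaf : WProg :=
  .load (fun v => { v with agree := true }) ;;
  readHead .tgt ;; move .aux (fun _ => false) [.frm] ;; countLetters ;;
  forEach .frm (pushCur .frm ;; readFrame .old ;; readFrame .qry ;; checkPair ;;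
    clear .old ;; clear .qry) ;;
  move .aux (fun _ => false) [.frm] ;; clear .tgt ;; clear .len ;;
  .load (fun v => { v with agree := false, up := true, val := !v.agree })

theorem runs_leaf_body [DecidableEq α] {num : α → ℕ} (hnum : Function.Injective num)
    {agree par up val done : Bool} {dict wrds rem aux rest : List Γ'} {w : Fin d → α}
    (x : Round α d) (hdB : d < B) (hBN : B ≤ N) (hw : (letters (nums num w)).length ≤ B)
    (hB : (roundStr num x ++ rest).length + aux.length ≤ B) :
    Runs B N (pushCur .frm ;; readFrame .old ;; readFrame .qry ;; checkPair ;;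
        clear .old ;; clear .qry)
      (popped .frm ⟨mem agree par up val done, cells dict wrds rem (roundStr num x ++ rest) aux
        (letters (nums num w)) [] [] (List.replicate d Γ'.blank)⟩)
      ⟨mem (agree && decide (response w x.2.1 = response x.1.1 x.2.1 ∧ w ≠ x.2.1)) par up val done,
        cells dict wrds rem rest ((roundStr num x).reverse ++ aux) (letters (nums num w)) [] []
          (List.replicate d Γ'.blank)⟩ := by
  obtain ⟨⟨w', l⟩, ⟨u, l'⟩⟩ := x
  simp only [roundStr] at hB ⊢
  have e1 : (frame num (w' :: l)).length = (letters (nums num w')).length + 1 +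
      (frame num l).length := by
    rw [frame_cons]; simp; omega
  have e2 : (frame num (u :: l')).length = (letters (nums num u)).length + 1 +
      (frame num l').length := by
    rw [frame_cons]; simp; omega
  obtain ⟨c, t, ht⟩ : ∃ c t, frame num (w' :: l) ++ frame num (u :: l') ++ rest = c :: t := by
    refine List.exists_cons_of_ne_nil fun h => ?_
    have := congrArg List.length h
    simp only [List.length_append, List.length_nil] at this
    omega
  have hlen := congrArg List.length ht
  simp only [List.length_append, List.length_cons] at hlen hB
  -- The surrounding loop has popped the first symbol of the frame in order to test for emptiness;
  -- it is put back first.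
  refine Runs.seq (t := ⟨{ mem agree par up val done with cur := some c },
      cells dict wrds rem (frame num (w' :: l) ++ (frame num (u :: l') ++ rest)) aux
        (letters (nums num w)) [] [] (List.replicate d Γ'.blank)⟩)
    ((runs_pushCur (c := c) (by simp [popped, cells, ht]) ?_).congr ?_) ?_
  · simp only [popped, cells, ht, List.tail_cons, Function.update_self]; omega
  · rw [← List.append_assoc]
    simp [popped, ht, update_cells_frm, cells]
  refine Runs.seq (runs_readFrame (k := .old) (num := num) (w := w') (l := l)
    (rest := frame num (u :: l') ++ rest) rfl rfl rfl hBN ?_ (by simp)) ?_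
  · simp only [cells]; omega
  simp only [update_cells_frm, update_cells_aux, update_cells_old, cells.eq_5]
  refine Runs.seq (runs_readFrame (k := .qry) (num := num) (w := u) (l := l')
    (rest := rest) rfl rfl rfl hBN ?_ (by simp)) ?_
  · simp only [cells, List.length_append, List.length_reverse]; omega
  simp only [update_cells_frm, update_cells_aux, update_cells_qry, cells.eq_5]
  refine Runs.seq (runs_checkPair (w := w) (w' := w') (u := u) hnum ⟨rfl, hw⟩
    ⟨rfl, by simp only [cells]; omega⟩ ⟨rfl, by simp only [cells]; omega⟩ ⟨rfl, hdB⟩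
    (scratch_cells _ _ _ _ _ _ _ _ _) rfl rfl rfl hBN) ?_
  refine Runs.seq (runs_clear (by simp only [cells]; omega)) ?_
  refine (runs_clear (by rw [update_cells_old]; simp only [cells]; omega)).congr ?_
  simp [update_cells_old, update_cells_qry, mem]


/-! ### Correctness of the check at a leaf. -/

open WordleInstance (encodeNumber response)

variable {B N : ℕ} {α : Type} {d : ℕ}

/-- The word chosen last is consistent with the responses in all rounds, and was never asked. -/
def LeafConsistent [DecidableEq α] (ps : List (Round α d)) (w : Fin d → α) : Prop :=
  ∀ x ∈ ps, response w x.2.1 = response x.1.1 x.2.1 ∧ w ≠ x.2.1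

instance [DecidableEq α] (ps : List (Round α d)) (w : Fin d → α) :
    Decidable (LeafConsistent ps w) :=
  inferInstanceAs (Decidable (∀ x ∈ ps, _))

/-- The front round contains the word chosen last, which is tested against every round while the
frames pass to `aux`; moving them back restores the position. The value is negated because a
surviving word is a loss. -/
theorem runs_leaf [DecidableEq α] {num : α → ℕ} (hnum : Function.Injective num)
    {agree par up val done : Bool} {dict wrds rem : List Γ'} (x : Round α d)
    (ps : List (Round α d)) (hdB : d < B) (hBN : B ≤ N)
    (hB : ((x :: ps).flatMap (roundStr num)).length ≤ B) :
    Runs B N leaf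
      ⟨mem agree par up val done, cells dict wrds rem ((x :: ps).flatMap (roundStr num)) [] [] [] []
        []⟩
      ⟨mem false par true (!decide (LeafConsistent (x :: ps) x.1.1)) done,
        cells dict wrds rem ((x :: ps).flatMap (roundStr num)) [] [] [] [] []⟩ := by
  set w := x.1.1 with hw
  set S := (x :: ps).flatMap (roundStr num) with hS
  obtain ⟨rest, hrest⟩ : ∃ rest, S = letters (nums num w) ++ Γ'.ket :: rest := by
    rw [hS, List.flatMap_cons, roundStr, frame_cons]
    simp only [List.append_assoc, List.cons_append]
    exact ⟨_, rfl⟩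
  have hSlen := congrArg List.length hrest
  simp only [List.length_append, List.length_cons] at hSlen
  let W := letters (nums num w)
  let M := List.replicate d Γ'.blank
  let st : List (Round α d) → List (Round α d) → WState := fun p q =>
    ⟨mem (decide (LeafConsistent p w)) par up val done,
      cells dict wrds rem (q.flatMap (roundStr num)) (p.flatMap (roundStr num)).reverse W [] [] M⟩
  have hloop := runs_forUntil (B := B) (N := N) (k := .frm) (halts := fun _ => false)
    (body := pushCur .frm ;; readFrame .old ;; readFrame .qry ;; checkPair ;;
      clear .old ;; clear .qry) (x :: ps) st ?_ ?_ (by simp [st, cells])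
  · refine Runs.seq (runs_load _ _) ?_
    refine Runs.seq (runs_readHead (L := nums num w) (rest := rest) hrest rfl hBN
      (by simp only [cells, List.length_nil]; omega) (by simp only [cells, List.length_nil]; omega)
      (.inl rfl)) ?_
    simp only [update_cells_frm, update_cells_aux, update_cells_tgt]
    simp only [cells.eq_5, cells.eq_6, List.append_nil]
    refine Runs.seq (t := ⟨mem true par up val done, cells dict wrds rem S [] W [] [] []⟩)
      ((runs_move (W ++ [Γ'.ket]).reverse [] (by simp [cells, W]) (by simp) (by simp)
        (by simp [W]; omega) (by simp [cells, W]; omega)).congr ?_) ?_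
    · simp only [mem]
      congr 1
      funext j
      cases j <;> simp [cells, W, hrest]
    refine Runs.seq ((runs_countLetters (L := nums num w) rfl rfl rfl hBN (by omega)).congr
      (t' := st [] (x :: ps)) ?_) (hloop.seq ?_)
    · simp [st, mem, update_cells_len, length_nums, LeafConsistent, M, hS]
    · simp only [st, update_cells_frm]
      refine Runs.seq (t := ⟨mem (decide (LeafConsistent (x :: ps) w)) par up val done,
          cells dict wrds rem S [] W [] [] M⟩)
        ((runs_move S.reverse [] (by simp [cells, hS]) (by simp) (by simp) (by simp; omega)
          (by simp [cells]; omega)).congr ?_) ?_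
      · simp only [mem]
        congr 1
        funext j
        cases j <;> simp [cells]
      refine Runs.seq (runs_clear (by simp only [cells, W]; omega)) ?_
      refine Runs.seq (runs_clear (by simp [cells, M]; omega)) ?_
      refine (runs_load _ _).congr ?_
      simp [update_cells_tgt, update_cells_len, mem]
  -- Every round occupies at least one symbol, so the stack length bounds the number of iterations.
  · have h1 : ∀ l : List (Round α d), l.length ≤ (l.flatMap (roundStr num)).length := by
      intro l
      induction l with
      | nil => simp
      | cons y l ih => simp [roundStr, frame]; omega
    exact (h1 _).trans (hB.trans hBN)
  · intro p y q hq
    have hlen : (p.flatMap (roundStr num)).length + ((y :: q).flatMap (roundStr num)).length =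
        S.length := by
      rw [hS, hq]; simp
    have hpos : 0 < (roundStr num y).length := by simp [roundStr, frame]
    refine ⟨?_, (runs_leaf_body (rest := q.flatMap (roundStr num)) hnum y hdB hBN (by omega)
      ?_).congr ?_⟩
    · obtain ⟨c, t, ht⟩ := List.exists_cons_of_length_pos hpos
      exact ⟨c, by simp [st, cells, ht], rfl⟩
    · simp only [List.flatMap_cons, List.length_append, List.length_reverse] at hlen ⊢
      omega
    · simp only [st]
      congr 1
      · congr 1
        have e : LeafConsistent (p ++ [y]) w ↔ LeafConsistent p w ∧
            (response w y.2.1 = response y.1.1 y.2.1 ∧ w ≠ y.2.1) := by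
          unfold LeafConsistent
          rw [List.forall_mem_append, List.forall_mem_singleton]
        rw [← Bool.decide_and]
        exact decide_eq_decide.2 e.symm
      · simp [W, M]


/-! ### One step of the depth-first traversal. -/

open WordleInstance (encodeNumber response)

variable {B N : ℕ} {α : Type} {d : ℕ}

/-- If the first frame has no words left, remove it and report failure; otherwise go down. -/
def settle : WProg :=
  popCur .frm ;;
  .ite (fun v => v.cur = some Γ'.blank)
    (pushSym .rem Γ'.blank ;;
      .load fun v => { v with par := !v.par, val := false, up := true, cur := none })
    (pushCur .frm ;; .load fun v => { v with up := false, cur := none })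

/-- One step of the traversal of the game tree. -/
def step : WProg :=
  .ite (fun v => v.up)
    (popCur .frm ;;
      .ite (fun v => v.cur.isNone) (.load fun v => { v with done := true })
        (pushCur .frm ;;
          .ite (fun v => v.val)
            (move .frm (fun c => c = Γ'.ket) [] ;; settle)
            (move .frm (fun c => c = Γ'.blank) [] ;; pushSym .rem Γ'.blank ;;
              .load fun v => { v with par := !v.par, val := true })))
    (popCur .rem ;;
      .ite (fun v => v.cur.isNone) leaf
        (.ite (fun v => v.par) (copy .dict .frm) (copy .wrds .frm) ;;
          .load (fun v => { v with par := !v.par }) ;; settle))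

/-- The states between the steps of the traversal. -/
def conf (dict wrds : List Γ') (par up val done : Bool) (n : ℕ) (frm : List Γ') : WState :=
  ⟨mem false par up val done,
    cells dict wrds (List.replicate n Γ'.blank) frm [] [] [] [] []⟩

/-- This justifies the test in `settle`: a frame begins with `blank` only if it has no words left.
Even an empty word is followed by `ket`. -/
theorem frame_cons_head (num : α → ℕ) (u : Fin d → α) (l : List (Fin d → α)) (F : List Γ') :
    ∃ c t, frame num (u :: l) ++ F = c :: t ∧ c ≠ Γ'.blank := by
  rw [frame_cons]
  rcases h : letters (nums num u) with _ | ⟨c, t⟩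
  · exact ⟨_, _, rfl, by simp⟩
  · exact ⟨c, _, rfl, (mem_letters (h ▸ List.mem_cons_self : c ∈ letters (nums num u))).2.1⟩

theorem runs_pushCur_popped {k : Stack} {s : WState} {c : Γ'} {t : List Γ'}
    (hk : s.stk k = c :: t) (hB : t.length < B) :
    Runs B N (pushCur k) (popped k s) ⟨{ s.var with cur := some c }, s.stk⟩ := by
  refine (runs_pushCur (c := c) (by simp [popped, hk]) (by simpa [popped, hk] using hB)).congr ?_
  have h : Function.update s.stk k (c :: t) = s.stk := by
    rw [← hk]; exact Function.update_eq_self _ _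
  simp [popped, hk, h]

variable {dict wrds F : List Γ'} {par up val : Bool} {n : ℕ}

theorem runs_settle_nil (num : α → ℕ) (hn : n < B) :
    Runs B N settle (conf dict wrds par up val false n (frame num ([] : List (Fin d → α)) ++ F))
      (conf dict wrds (!par) true false false (n + 1) F) := by
  refine Runs.seq (runs_popCur _ _) (Runs.ite_true (by simp [popped, conf, cells, frame_nil]) ?_)
  refine Runs.seq (runs_pushSym _ (by simp [popped, conf, cells]; omega))
    ((runs_load _ _).congr ?_)
  simp [popped, conf, update_cells_frm, update_cells_rem, mem, frame_nil, cells,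
    List.replicate_succ]

theorem runs_settle_cons (num : α → ℕ) (u : Fin d → α) (l : List (Fin d → α))
    (hB : (frame num (u :: l) ++ F).length ≤ B) :
    Runs B N settle (conf dict wrds par up val false n (frame num (u :: l) ++ F))
      (conf dict wrds par false val false n (frame num (u :: l) ++ F)) := by
  obtain ⟨c, t, ht, hc⟩ := frame_cons_head num u l F
  rw [ht] at hB ⊢
  refine Runs.seq (runs_popCur _ _) (Runs.ite_false (by simp [popped, conf, cells, hc]) ?_)
  exact Runs.seq (runs_pushCur_popped (c := c) (t := t) rfl (by simpa using hB))
    ((runs_load _ _).congr rfl)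

/-- A mark of `rem` pays for opening a level, and `par` selects the list to copy. An empty list has
no false child, so its level is closed at once with the value false and the mark is returned. -/
theorem runs_step_down (num : α → ℕ) (L : List (Fin d → α))
    (hL : (if par then dict else wrds) = frame num L) (hBN : B ≤ N)
    (hB : (frame num L ++ F).length ≤ B) (hn : n < B) :
    Runs B N step (conf dict wrds par false val false (n + 1) F)
      (if L = [] then conf dict wrds par true false false (n + 1) F
        else conf dict wrds (!par) false val false n (frame num L ++ F)) := by
  rw [List.length_append] at hB
  refine Runs.ite_false rfl ?_
  refine Runs.seq (runs_popCur _ _)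
    (Runs.ite_false (by simp [popped, conf, cells, List.replicate_succ]) ?_)
  have e : popped .rem (conf dict wrds par false val false (n + 1) F) =
      ⟨{ mem false par false val false with cur := some Γ'.blank },
        cells dict wrds (List.replicate n Γ'.blank) F [] [] [] [] []⟩ := by
    simp [popped, conf, update_cells_rem, cells, List.replicate_succ]
  rw [e]
  refine Runs.seq (t := ⟨mem false par false val false,
    cells dict wrds (List.replicate n Γ'.blank) (frame num L ++ F) [] [] [] [] []⟩) ?_ ?_
  · cases par with
    | true =>
      simp only [if_true] at hL
      subst hL
      refine Runs.ite_true rfl ((runs_copy rfl (by simp only [cells]; omega)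
        (by simp only [cells]; omega)).congr ?_)
      rw [update_cells_frm]
      rfl
    | false =>
      simp only [Bool.false_eq_true, if_false] at hL
      subst hL
      refine Runs.ite_false rfl ((runs_copy rfl (by simp only [cells]; omega)
        (by simp only [cells]; omega)).congr ?_)
      rw [update_cells_frm]
      rfl
  · refine Runs.seq (runs_load _ _) ?_
    cases L with
    | nil =>
      have := runs_settle_nil (B := B) (N := N) (d := d) (dict := dict) (wrds := wrds) (F := F)
        (par := !par) (up := false) (val := val) num hn
      simpa [conf, mem] using this
    | cons u l =>
      have := runs_settle_cons (B := B) (N := N) (dict := dict) (wrds := wrds) (F := F) (n := n)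
        (par := !par) (up := false) (val := val) num u l (by rw [List.length_append]; omega)
      simpa [conf, mem] using this

/-- One false child makes the level true, so all remaining choices are discarded. -/
theorem runs_step_up_false (num : α → ℕ) (l : List (Fin d → α)) (hBN : B ≤ N)
    (hB : (frame num l ++ F).length ≤ B) (hn : n < B) :
    Runs B N step (conf dict wrds par true false false n (frame num l ++ F))
      (conf dict wrds (!par) true true false (n + 1) F) := by
  obtain ⟨c, t, ht⟩ : ∃ c t, frame num l ++ F = c :: t := by
    refine List.exists_cons_of_ne_nil fun h => ?_
    simp [frame] at h
  have hlen := congrArg List.length ht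
  rw [List.length_cons] at hlen
  refine Runs.ite_true rfl ?_
  refine Runs.seq (runs_popCur _ _) (Runs.ite_false (by simp [popped, conf, cells, ht]) ?_)
  refine Runs.seq (runs_pushCur_popped ht (by omega)) ?_
  refine Runs.ite_false rfl ?_
  refine Runs.seq (runs_move (l.flatMap fun u => letters (nums num u) ++ [Γ'.ket])
    (Γ'.blank :: F) ?_ ?_ (by simp) ?_ (by simp)) ?_
  · simp [conf, cells, frame]
  · intro x hx
    simp only [decide_eq_false_iff_not]
    rintro rfl
    exact blank_notMem_words num l hx
  · simp [frame] at hB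
    simp; omega
  · refine Runs.seq (runs_pushSym _ (by simp [conf, cells]; omega))
      ((runs_load _ _).congr ?_)
    simp only [conf, mem]
    congr 1
    funext j
    cases j <;> simp [cells, List.replicate_succ]

/-- A true child decides nothing: it is dropped, and the level is false if it was the last one. -/
theorem runs_step_up_true (num : α → ℕ) (u : Fin d → α) (l : List (Fin d → α)) (hBN : B ≤ N)
    (hB : (frame num (u :: l) ++ F).length ≤ B) (hn : n < B) :
    Runs B N step (conf dict wrds par true true false n (frame num (u :: l) ++ F))
      (if l = [] then conf dict wrds (!par) true false false (n + 1) F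
        else conf dict wrds par false true false n (frame num l ++ F)) := by
  obtain ⟨c, t, ht, -⟩ := frame_cons_head num u l F
  have hlen := congrArg List.length ht
  rw [List.length_cons] at hlen
  have e1 : (frame num (u :: l)).length = (letters (nums num u)).length + 1 +
      (frame num l).length := by
    rw [frame_cons]; simp; omega
  rw [List.length_append] at hlen hB
  refine Runs.ite_true rfl ?_
  refine Runs.seq (runs_popCur _ _) (Runs.ite_false (by simp [popped, conf, cells, ht]) ?_)
  refine Runs.seq (runs_pushCur_popped ht (by omega)) ?_
  refine Runs.ite_true rfl ?_
  refine Runs.seq (t := conf dict wrds par true true false n (frame num l ++ F))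
    ((runs_move (letters (nums num u)) (Γ'.ket :: (frame num l ++ F)) ?_ ?_ (by simp) (by omega)
      (by simp)).congr ?_) ?_
  · simp [conf, cells, frame_cons]
  · exact fun x hx => by simpa using (mem_letters hx).1
  · simp only [conf, mem]
    congr 1
    funext j
    cases j <;> simp [cells]
  · cases l with
    | nil => exact runs_settle_nil num hn
    | cons v l =>
      rw [if_neg (by simp)]
      exact runs_settle_cons num v l (by rw [List.length_append]; omega)

theorem runs_step_done :
    Runs B N step (conf dict wrds par true val false n [])
      (conf dict wrds par true val true n []) := by
  refine Runs.ite_true rfl (Runs.seq (runs_popCur _ _) (Runs.ite_true rfl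
    ((runs_load _ _).congr ?_)))
  simp [popped, conf, update_cells_frm, mem, cells]

theorem runs_step_leaf [DecidableEq α] {num : α → ℕ} (hnum : Function.Injective num)
    (x : Round α d) (ps : List (Round α d)) (hdB : d < B) (hBN : B ≤ N)
    (hB : ((x :: ps).flatMap (roundStr num)).length ≤ B) :
    Runs B N step (conf dict wrds par false val false 0 ((x :: ps).flatMap (roundStr num)))
      (conf dict wrds par true (!decide (LeafConsistent (x :: ps) x.1.1)) false 0
        ((x :: ps).flatMap (roundStr num))) := by
  refine Runs.ite_false rfl (Runs.seq (runs_popCur _ _) (Runs.ite_true rfl ?_))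
  have e : popped .rem (conf dict wrds par false val false 0 ((x :: ps).flatMap (roundStr num))) =
      ⟨mem false par false val false,
        cells dict wrds [] ((x :: ps).flatMap (roundStr num)) [] [] [] [] []⟩ := by
    simp [popped, conf, update_cells_rem, cells, mem]
  rw [e]
  exact runs_leaf hnum x ps hdB hBN hB


/-! ### The traversal evaluates the game formula. -/

open WordleInstance (Forced Consistent)

variable {B N : ℕ} {α : Type} {d : ℕ}

/-- One iteration of the main loop. -/
def Step (B N : ℕ) (s t : WState) : Prop := (!s.var.done) = true ∧ Runs B N step s t

theorem length_frame_le_of_suffix (num : α → ℕ) {l L : List (Fin d → α)} (h : l <:+ L) :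
    (frame num l).length ≤ (frame num L).length := by
  obtain ⟨p, rfl⟩ := h
  simp [frame]

/-- The rule for one level of the game tree: if the traversal evaluates each child `u` to the truth
value of `Q u`, it evaluates the level to that of `∃ u ∈ L, ¬ Q u`. -/
theorem iter_level {num : α → ℕ} {dict wrds F : List Γ'} {par : Bool} {n T : ℕ}
    {L : List (Fin d → α)} (Q : (Fin d → α) → Prop)
    (hL : (if par then dict else wrds) = frame num L) (hBN : B ≤ N)
    (hB : (frame num L ++ F).length ≤ B) (hn : n < B)
    (hQ : ∀ u l, u :: l <:+ L → ∀ v, ∃ b, (b = true ↔ Q u) ∧ ∃ t ≤ T, Iter (Step B N) t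
      (conf dict wrds (!par) false v false n (frame num (u :: l) ++ F))
      (conf dict wrds (!par) true b false n (frame num (u :: l) ++ F))) (v : Bool) :
    ∃ b, (b = true ↔ ∃ u ∈ L, ¬ Q u) ∧ ∃ t ≤ 1 + L.length * (T + 1), Iter (Step B N) t
      (conf dict wrds par false v false (n + 1) F) (conf dict wrds par true b false (n + 1) F) := by
  have hsuf : ∀ l : List (Fin d → α), l <:+ L → (frame num l ++ F).length ≤ B := by
    intro l hl
    have := length_frame_le_of_suffix num hl
    rw [List.length_append] at hB ⊢
    omega
  -- The induction is on the choices still to be tried. The value `v` is left over from earlier work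
  -- and is arbitrary, since it is not read on the way down.
  have key : ∀ l : List (Fin d → α), l <:+ L → l ≠ [] → ∀ v,
      ∃ b, (b = true ↔ ∃ u ∈ l, ¬ Q u) ∧ ∃ t ≤ l.length * (T + 1), Iter (Step B N) t
        (conf dict wrds (!par) false v false n (frame num l ++ F))
        (conf dict wrds par true b false (n + 1) F) := by
    intro l
    induction l with
    | nil => intro _ h; exact absurd rfl h
    | cons u l ih =>
      intro hl _ v
      obtain ⟨b, hb, t, ht, hit⟩ := hQ u l hl v
      cases b with
      | false =>
        refine ⟨true, ?_, t + 1, ?_, hit.trans (.single ⟨rfl, ?_⟩)⟩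
        · simp only [true_iff]
          exact ⟨u, by simp, fun h => by simpa using hb.2 h⟩
        · rw [List.length_cons, Nat.succ_mul]; omega
        · have := runs_step_up_false (N := N) (dict := dict) (wrds := wrds) (par := !par) (F := F)
            num (u :: l) hBN (hsuf _ hl) hn
          rwa [Bool.not_not] at this
      | true =>
        have hstep := runs_step_up_true (N := N) (dict := dict) (wrds := wrds) (par := !par)
          (F := F) num u l hBN (hsuf _ hl) hn
        rw [Bool.not_not] at hstep
        have hu : Q u := hb.1 rfl
        by_cases hl0 : l = []
        · rw [if_pos hl0] at hstep
          refine ⟨false, ?_, t + 1, ?_, hit.trans (.single ⟨rfl, hstep⟩)⟩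
          · simp [hl0, hu]
          · rw [List.length_cons, Nat.succ_mul]; omega
        · rw [if_neg hl0] at hstep
          obtain ⟨b', hb', t', ht', hit'⟩ := ih ((List.suffix_cons u l).trans hl) hl0 true
          refine ⟨b', ?_, t + (t' + 1), ?_, hit.trans (.succ ⟨rfl, hstep⟩ hit')⟩
          · rw [hb']; simp [hu]
          · rw [List.length_cons, Nat.succ_mul]; omega
  have hstep := runs_step_down (N := N) (val := v) num L hL hBN hB hn
  by_cases hL0 : L = []
  · rw [if_pos hL0] at hstep
    exact ⟨false, by simp [hL0], 1, by omega, .single ⟨rfl, hstep⟩⟩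
  · rw [if_neg hL0] at hstep
    obtain ⟨b, hb, t, ht, hit⟩ := key L (List.suffix_refl L) hL0 v
    exact ⟨b, hb, t + 1, by omega, .succ ⟨rfl, hstep⟩ hit⟩

/-- The query and the chosen word of each round. -/
def rounds (ps : List (Round α d)) : List ((Fin d → α) × (Fin d → α)) :=
  ps.map fun x => (x.2.1, x.1.1)

/-- A bound for the number of iterations that evaluate a position with `n` rounds to go. -/
def iterBound (m : ℕ) : ℕ → ℕ
  | 0 => 1
  | n + 1 => 1 + m * (1 + m * (iterBound m n + 1) + 1)

/-- With the summand `1` included, each round multiplies the bound by at most `(m + 2) ^ 2`. That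
summand also pays for the final iteration that sets `done`. -/
theorem iterBound_succ_le (m n : ℕ) : iterBound m n + 1 ≤ 2 * (m + 2) ^ (2 * n) := by
  induction n with
  | zero => simp [iterBound]
  | succ n ih =>
    have h1 : iterBound m (n + 1) + 1 ≤ (m + 2) * ((m + 2) * (iterBound m n + 1)) := by
      rw [iterBound]; nlinarith
    calc _ ≤ _ := h1
      _ ≤ (m + 2) * ((m + 2) * (2 * (m + 2) ^ (2 * n))) := by gcongr
      _ = 2 * (m + 2) ^ (2 * (n + 1)) := by ring

/-- A round is two levels, so `2 * n` marks stand for `n` rounds. The untried choices stored in `ps`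
influence the stack but not the formula, which sees only `rounds ps`. A leaf needs at least one
round, whence `hps`. -/
theorem iter_rounds [DecidableEq α] {WI : WordleInstance α} {num : α → ℕ}
    (hnum : Function.Injective num) {D W : List (Fin WI.d → α)} (hD : ∀ u, u ∈ D ↔ u ∈ WI.D)
    (hW : ∀ w, w ∈ W ↔ w ∈ WI.W) {m : ℕ} (hDm : D.length ≤ m) (hWm : W.length ≤ m)
    (hdB : WI.d < B) (hBN : B ≤ N) (n : ℕ) (ps : List (Round α WI.d)) (hps : n = 0 → ps ≠ [])
    (hB : (ps.flatMap (roundStr num)).length + n * ((frame num D).length + (frame num W).length)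
      ≤ B) (hn : 2 * n < B) (v : Bool) :
    ∃ b, (b = true ↔ Forced WI n (rounds ps)) ∧ ∃ t ≤ iterBound m n, Iter (Step B N) t
      (conf (frame num D) (frame num W) true false v false (2 * n) (ps.flatMap (roundStr num)))
      (conf (frame num D) (frame num W) true true b false (2 * n) (ps.flatMap (roundStr num))) := by
  induction n generalizing ps v with
  | zero =>
    obtain ⟨x, ps, rfl⟩ := List.exists_cons_of_ne_nil (hps rfl)
    refine ⟨_, ?_, 1, le_rfl, .single ⟨rfl, runs_step_leaf hnum x ps hdB hBN (by omega)⟩⟩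
    simp only [Bool.not_eq_true', decide_eq_false_iff_not]
    have : Forced WI 0 (rounds (x :: ps)) ↔ ¬ Consistent (rounds (x :: ps)) x.1.1 := Iff.rfl
    rw [this]
    simp only [LeafConsistent, Consistent, rounds, List.forall_mem_map]
  | succ n ih =>
    rw [Nat.succ_mul] at hB
    -- The child of a query is the word level with value "some word fails"; negating it at the query
    -- level gives "every word succeeds".
    have h := iter_level (num := num) (B := B) (N := N) (dict := frame num D) (wrds := frame num W)
      (F := ps.flatMap (roundStr num)) (par := true) (n := 2 * n + 1)
      (T := 1 + m * (iterBound m n + 1)) (L := D)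
      (fun u => ∃ w ∈ W, ¬ Forced WI n ((u, w) :: rounds ps)) rfl hBN
      (by rw [List.length_append]; omega) (by omega) ?_ v
    · obtain ⟨b, hb, t, ht, hit⟩ := h
      refine ⟨b, ?_, t, ht.trans ?_, hit⟩
      · rw [hb, Forced]
        simp only [hD, hW, not_exists, not_and, not_not]
      · rw [iterBound]
        gcongr
    · intro u l hl v
      have h1 := length_frame_le_of_suffix num hl
      obtain ⟨b, hb, t, ht, hit⟩ := iter_level (num := num) (B := B) (N := N) (dict := frame num D)
        (wrds := frame num W) (F := frame num (u :: l) ++ ps.flatMap (roundStr num)) (par := false)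
        (n := 2 * n) (T := iterBound m n) (L := W) (fun w => Forced WI n ((u, w) :: rounds ps)) rfl
        hBN (by simp only [List.length_append]; omega) (by omega) (fun w l' hl' v => by
          have h2 := length_frame_le_of_suffix num hl'
          have := ih (((w, l'), (u, l)) :: ps) (by simp) (by
            simp only [List.flatMap_cons, roundStr, List.length_append]; omega) (by omega) v
          simpa [rounds, roundStr] using this) v
      refine ⟨b, hb, t, ht.trans ?_, hit⟩
      gcongr


/-! ### Reading the input, and the complete program. -/

open WordleInstance (encodeNumber Forced)

variable {B N : ℕ}

/-- Double the number that is written in unary in `rem`. -/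
def double : WProg :=
  move .rem (fun _ => false) [.tmp, .aux] ;; move .tmp (fun _ => false) [.rem] ;;
  move .aux (fun _ => false) [.rem]

/-- Convert the binary number in `num`, most significant digit first, to unary. -/
def toUnary : WProg :=
  forEach .num (.load (fun v => { v with bit := decide (v.cur = some (Γ'.bit true)) }) ;; double ;;
    .ite (fun v => v.bit) (pushSym .rem Γ'.blank) skip ;; .load fun v => { v with bit := false })

/-- Read a list of words from the input to the stack `k`. -/
def parseList (k : Stack) : WProg :=
  popCur .inp ;;
  forUntil .inp (fun c => c = Γ'.ket)
    (move .inp (fun c => c = Γ'.ket) [.tmp] ;; pushSym .tmp Γ'.ket) ;;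
  pushSym .tmp Γ'.blank ;; move .tmp (fun _ => false) [k]

/-- Read the input. -/
def parse : WProg :=
  move .inp (fun c => c = Γ'.comma) [] ;; move .inp (fun c => c = Γ'.comma) [] ;;
  move .inp (fun c => c = Γ'.comma) [.num] ;; toUnary ;; double ;;
  parseList .dict ;; parseList .wrds

/-- The program that decides whether there is a winning strategy. -/
def main : WProg :=
  parse ;; .load (fun v => { v with par := true }) ;; .loop (fun v => !v.done) step ;;
  clear .dict ;; clear .wrds ;; clear .rem

/-- The contents of the stacks while the input is read. -/
def inputCells (inp num rem dict wrds tmp : List Γ') : Stack → List Γ'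
  | .inp => inp
  | .num => num
  | .rem => rem
  | .dict => dict
  | .wrds => wrds
  | .tmp => tmp
  | _ => []

theorem runs_double {v : Mem} {inp num dict wrds : List Γ'} {n : ℕ} (hn : 2 * n ≤ B)
    (hBN : B ≤ N) :
    Runs B N double ⟨v, inputCells inp num (List.replicate n Γ'.blank) dict wrds []⟩
      ⟨{ v with cur := none },
        inputCells inp num (List.replicate (2 * n) Γ'.blank) dict wrds []⟩ := by
  refine Runs.seq (runs_move (List.replicate n Γ'.blank) [] (by simp [inputCells]) (by simp)
    (by simp) (by simp; omega) (by simp [inputCells]; omega)) ?_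
  refine Runs.seq (runs_move (List.replicate n Γ'.blank) [] (by simp [inputCells]) (by simp)
    (by simp) (by simp; omega) (by simp; omega)) ?_
  refine (runs_move (List.replicate n Γ'.blank) [] (by simp [inputCells]) (by simp)
    (by simp) (by simp; omega) (by simp; omega)).congr ?_
  congr 1
  funext j
  cases j <;> simp [inputCells, two_mul]

/-- The number with the given binary digits, most significant first. -/
def ofDigits (l : List Bool) : ℕ := l.foldl (fun n b => Nat.bit b n) 0

theorem ofDigits_append_singleton (l : List Bool) (b : Bool) :
    ofDigits (l ++ [b]) = Nat.bit b (ofDigits l) := by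
  simp [ofDigits]

theorem ofDigits_le_append (p q : List Bool) : ofDigits p ≤ ofDigits (p ++ q) := by
  induction q using List.reverseRecOn with
  | nil => simp
  | append_singleton q b ih =>
    rw [← List.append_assoc, ofDigits_append_singleton]
    refine ih.trans ?_
    rw [Nat.bit_val]
    omega

theorem ofDigits_reverse_bits (n : ℕ) : ofDigits (Nat.bits n).reverse = n := by
  induction n using Nat.binaryRec' with
  | zero => simp [ofDigits]
  | bit b n hb ih =>
    rw [Nat.bits_append_bit _ _ hb, List.reverse_cons, ofDigits_append_singleton, ih]

/-- Horner's scheme; moving the digits off the input has put the most significant one on top.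
Intermediate values never exceed `n`, by `ofDigits_le_append`, so the stacks stay within `B`. -/
theorem runs_toUnary {inp dict wrds : List Γ'} {n : ℕ} (hn : n ≤ B) (hBN : B ≤ N)
    (hlen : (Nat.bits n).length ≤ N) :
    Runs B N toUnary ⟨mem false false false false false,
        inputCells inp ((Nat.bits n).map Γ'.bit).reverse [] dict wrds []⟩
      ⟨mem false false false false false,
        inputCells inp [] (List.replicate n Γ'.blank) dict wrds []⟩ := by
  let st : List Bool → List Bool → WState := fun p q => ⟨mem false false false false false,
    inputCells inp (q.map Γ'.bit) (List.replicate (ofDigits p) Γ'.blank) dict wrds []⟩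
  have hloop := runs_forUntil (B := B) (N := N) (k := .num) (halts := fun _ => false)
    (body := .load (fun v => { v with bit := decide (v.cur = some (Γ'.bit true)) }) ;; double ;;
    .ite (fun v => v.bit) (pushSym .rem Γ'.blank) skip ;; .load fun v => { v with bit := false })
    (Nat.bits n).reverse st (by simpa using hlen) ?_ (by simp [st, inputCells])
  · have e : st [] (Nat.bits n).reverse = ⟨mem false false false false false,
        inputCells inp ((Nat.bits n).map Γ'.bit).reverse [] dict wrds []⟩ := by
      simp [st, ofDigits]
    rw [← e]
    refine hloop.congr ?_
    simp only [st, ofDigits_reverse_bits, mem]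
    congr 1
    funext j
    cases j <;> simp [inputCells]
  · intro p b q hq
    have hle : ofDigits (p ++ [b]) ≤ n := by
      have := ofDigits_le_append (p ++ [b]) q
      rwa [List.append_assoc, List.singleton_append, ← hq, ofDigits_reverse_bits] at this
    rw [ofDigits_append_singleton, Nat.bit_val] at hle
    refine ⟨⟨Γ'.bit b, by simp [st, inputCells], rfl⟩, ?_⟩
    have e : popped .num (st p (b :: q)) =
        ⟨{ mem false false false false false with cur := some (Γ'.bit b) },
          inputCells inp (q.map Γ'.bit) (List.replicate (ofDigits p) Γ'.blank) dict wrds []⟩ := by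
      simp only [popped, st]
      congr 1
      funext j
      cases j <;> simp [inputCells]
    rw [e]
    refine Runs.seq (runs_load _ _) (Runs.seq (runs_double (by omega) hBN) ?_)
    cases b with
    | true =>
      refine Runs.seq (Runs.ite_true rfl (runs_pushSym _ ?_)) ((runs_load _ _).congr ?_)
      · simp only [Bool.toNat_true] at hle
        simp [inputCells]
        omega
      · simp only [st, mem, ofDigits_append_singleton, Nat.bit_val]
        congr 1
        funext j
        cases j <;> simp [inputCells, List.replicate_succ]
    | false =>
      refine Runs.seq (Runs.ite_false rfl (runs_skip _)) ((runs_load _ _).congr ?_)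
      simp only [st, mem, ofDigits_append_singleton, Nat.bit_val]
      congr 1

variable {α : Type} {d : ℕ}

/-- A list of words, as it is written in the input. -/
def wordsStr (num : α → ℕ) (l : List (Fin d → α)) : List Γ' :=
  Γ'.bra :: (l.flatMap fun u => Γ'.bra :: (letters (nums num u) ++ [Γ'.ket])) ++ [Γ'.ket]

theorem length_wordsStr (num : α → ℕ) (l : List (Fin d → α)) :
    (wordsStr num l).length = (frame num l).length + l.length + 1 := by
  induction l with
  | nil => rfl
  | cons u l ih =>
    simp only [wordsStr, frame_cons, List.flatMap_cons, List.length_append, List.length_cons,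
      List.length_nil] at ih ⊢
    omega

/-- The outer loop consumes the opening bracket of each word, or the closing bracket of the list and
stops. Two passes through `tmp` and `k` preserve the order. -/
theorem runs_parseList {num : α → ℕ} (l : List (Fin d → α)) {k : Stack} {f : Stack → List Γ'}
    {rest : List Γ'} (hinp : f .inp = wordsStr num l ++ rest) (htmp : f .tmp = [])
    (hk : f k = []) (hB : (wordsStr num l).length ≤ B) (hBN : B ≤ N)
    (hk' : k = .dict ∨ k = .wrds) :
    Runs B N (parseList k) ⟨mem false false false false false, f⟩
      ⟨mem false false false false false,
        Function.update (Function.update f .inp rest) k (frame num l)⟩ := by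
  have hk1 : k ≠ .inp ∧ k ≠ .tmp := by rcases hk' with rfl | rfl <;> decide
  have hlen := length_wordsStr num l
  let st : List (Fin d → α) → List (Fin d → α) → WState := fun p q =>
    ⟨{ mem false false false false false with
        cur := if p = [] then some Γ'.bra else none },
      Function.update (Function.update f .inp
        ((q.flatMap fun u => Γ'.bra :: (letters (nums num u) ++ [Γ'.ket])) ++ Γ'.ket :: rest)) .tmp
        (p.flatMap fun u => letters (nums num u) ++ [Γ'.ket]).reverse⟩
  have hloop := runs_forUntil (B := B) (N := N) (k := .inp) (halts := fun c => c = Γ'.ket)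
    (body := move .inp (fun c => c = Γ'.ket) [.tmp] ;; pushSym .tmp Γ'.ket)
    l st (by omega) ?_ (by simp [st])
  · refine Runs.seq (t := st [] l) ((runs_popCur _ _).congr ?_) (hloop.seq ?_)
    · simp only [st, popped, hinp, wordsStr]
      congr 1
      funext j
      by_cases h1 : j = .tmp
      · subst h1; simp [htmp]
      · by_cases h2 : j = .inp
        · subst h2; simp
        · simp [h1, h2]
    · have e : (frame num l).length =
        (l.flatMap fun u => letters (nums num u) ++ [Γ'.ket]).length + 1 := by simp [frame]
      refine Runs.seq (runs_pushSym _ ?_) ((runs_move (frame num l).reverse [] ?_ (by simp)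
        (by simp) ?_ ?_ (by simp) ?_).congr ?_)
      · simp only [st, ne_eq, reduceCtorEq, not_false_eq_true, Function.update_of_ne,
          Function.update_self, List.length_reverse]
        omega
      · simp [st, frame]
      · rw [List.length_reverse]; omega
      · simp [st, hk1.1, hk1.2, hk]; omega
      · simp [hk1.2.symm]
      · simp only [st]
        congr 1
        funext j
        by_cases h3 : j = k
        · subst h3; simp [hk1.1, hk1.2, hk]
        · by_cases h1 : j = .tmp
          · subst h1; simp [htmp, h3]
          · by_cases h2 : j = .inp
            · subst h2; simp [h3]
            · simp [h1, h2, h3]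
  · intro p u q hq
    refine ⟨⟨Γ'.bra, by simp [st], by simp⟩, ?_⟩
    have hl : (p.flatMap fun u => letters (nums num u) ++ [Γ'.ket]).length +
        ((letters (nums num u)).length + 1) ≤ B := by
      have := congrArg (fun l => (frame num l).length) hq
      simp only [frame, List.flatMap_append, List.flatMap_cons, List.length_append,
        List.length_cons, List.length_nil] at this hlen ⊢
      omega
    refine Runs.seq (runs_move (letters (nums num u)) (Γ'.ket ::
      ((q.flatMap fun u => Γ'.bra :: (letters (nums num u) ++ [Γ'.ket])) ++ Γ'.ket :: rest))
      ?_ (fun c hc => by simpa using (mem_letters hc).1) (by simp) (by omega) ?_)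
      ((runs_pushSym _ ?_).congr ?_)
    · simp [popped, st]
    · simp only [List.mem_singleton, forall_eq, popped, st, ne_eq, reduceCtorEq, not_false_eq_true,
          Function.update_of_ne, Function.update_self, List.length_reverse]
      omega
    · simp only [popped, st, ne_eq, reduceCtorEq, not_false_eq_true,
          Function.update_of_ne, Function.update_self, List.length_reverse, if_false,
          List.mem_singleton, if_true, List.length_append]
      omega
    · simp only [popped, st]
      congr 1
      · simp
      · funext j
        by_cases h1 : j = .tmp
        · subst h1; simp
        · by_cases h2 : j = .inp
          · subst h2; simp
          · simp [h1, h2]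

section Presentation

variable {WI : WordleInstance α} [Fintype α] (P : WI.Presentation)

/-- The number of a letter. -/
def letterNum (a : α) : ℕ := P.num a

theorem letterNum_injective : Function.Injective (letterNum P) :=
  fun _ _ h => P.num.injective (Fin.ext h)

theorem encode_eq : P.encode = encodeNumber (Fintype.card α) ++ encodeNumber WI.d ++
    encodeNumber WI.g ++ wordsStr (letterNum P) P.dict ++ wordsStr (letterNum P) P.words := by
  have h : ∀ u, P.encodeWord u = Γ'.bra :: (letters (nums (letterNum P) u) ++ [Γ'.ket]) := by
    intro u
    rw [WordleInstance.Presentation.encodeWord, letters, nums, List.flatMap_map]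
    rfl
  simp only [WordleInstance.Presentation.encode, WordleInstance.Presentation.encodeWords, wordsStr,
    funext h]

theorem size_eq : P.size = (encodeNumber (Fintype.card α)).length + (encodeNumber WI.d).length +
    (encodeNumber WI.g).length + (wordsStr (letterNum P) P.dict).length +
    (wordsStr (letterNum P) P.words).length := by
  simp only [WordleInstance.Presentation.size, encode_eq, List.length_append]

/-- The alphabet size and the dimension are discarded. The game length is doubled once more after
conversion, to count one level for the query and one for the word of each round. -/
theorem runs_parse (hB : P.size ≤ B) (hg : 2 * WI.g ≤ B) (hBN : B ≤ N) :
    Runs B N parse ⟨mem false false false false false,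
        Function.update (fun _ => []) .inp P.encode⟩
      ⟨mem false false false false false,
        cells (frame (letterNum P) P.dict) (frame (letterNum P) P.words)
          (List.replicate (2 * WI.g) Γ'.blank) [] [] [] [] [] []⟩ := by
  have hsize := size_eq P
  have e1 : ∀ n : ℕ, (encodeNumber n).length = (Nat.bits n).length + 1 := by
    intro n; simp [encodeNumber]
  simp only [e1] at hsize
  have hc : ∀ (n : ℕ), ∀ c ∈ (Nat.bits n).map Γ'.bit, decide (c = Γ'.comma) = false := by
    intro n c h
    obtain ⟨b, _, rfl⟩ := List.mem_map.1 h
    simp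
  set Ds := wordsStr (letterNum P) P.dict with hDs
  set Ws := wordsStr (letterNum P) P.words with hWs
  have henc : P.encode = (Nat.bits (Fintype.card α)).map Γ'.bit ++ Γ'.comma ::
      ((Nat.bits WI.d).map Γ'.bit ++ Γ'.comma :: ((Nat.bits WI.g).map Γ'.bit ++ Γ'.comma ::
        (Ds ++ Ws))) := by
    rw [encode_eq]; simp [encodeNumber, hDs, hWs]
  have e0 : Function.update (fun _ => []) .inp P.encode =
      inputCells P.encode [] [] [] [] [] := by
    funext j
    cases j <;> simp [inputCells]
  rw [e0]
  refine Runs.seq (t := ⟨mem false false false false false, inputCells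
    ((Nat.bits WI.d).map Γ'.bit ++ Γ'.comma :: ((Nat.bits WI.g).map Γ'.bit ++ Γ'.comma ::
        (Ds ++ Ws))) [] [] [] [] []⟩)
    ((runs_move _ _ henc (hc _) (by simp) (by simp; omega) (by simp)).congr ?_) ?_
  · simp only [mem]
    congr 1
    funext j
    cases j <;> simp [inputCells]
  refine Runs.seq (t := ⟨mem false false false false false, inputCells
    ((Nat.bits WI.g).map Γ'.bit ++ Γ'.comma :: (Ds ++ Ws)) [] [] [] [] []⟩)
    ((runs_move _ _ rfl (hc _) (by simp) (by simp; omega) (by simp)).congr ?_) ?_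
  · simp only [mem]
    congr 1
    funext j
    cases j <;> simp [inputCells]
  refine Runs.seq (t := ⟨mem false false false false false, inputCells
    (Ds ++ Ws) ((Nat.bits WI.g).map Γ'.bit).reverse [] [] [] []⟩)
    ((runs_move _ _ rfl (hc _) (by simp) (by simp; omega)
      (by simp [inputCells]; omega)).congr ?_) ?_
  · simp only [mem]
    congr 1
    funext j
    cases j <;> simp [inputCells]
  refine Runs.seq (runs_toUnary (by omega) hBN (by omega)) ?_
  refine Runs.seq (runs_double hg hBN) ?_
  refine Runs.seq (runs_parseList (num := letterNum P) P.dict (rest := Ws) rfl rfl rfl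
    (by rw [← hDs]; omega)
    hBN (.inl rfl)) ?_
  refine (runs_parseList (num := letterNum P) P.words (rest := []) ?_ rfl rfl
    (by rw [← hWs]; omega) hBN (.inr rfl)).congr ?_
  · simp [hWs]
  · congr 1
    funext j
    cases j <;> simp [inputCells, cells]

end Presentation

end StackProg

/-! ### Final time and space bounds. -/

theorem DecidesInTime.mono {Γ₀ : Type} {M : Turing.TM2ComputableAux Γ₀ Bool} {x : List Γ₀}
    {P : Prop} {t t' : ℕ} (h : DecidesInTime M x P t) (ht : t ≤ t') : DecidesInTime M x P t' := by
  obtain ⟨b, hb, ⟨ho⟩⟩ := h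
  exact ⟨b, hb, ⟨⟨ho.toEvalsTo, ho.steps_le_m.trans ht⟩⟩⟩

theorem RunsInSpace.mono {Γ₀ : Type} {M : Turing.TM2ComputableAux Γ₀ Bool} {x : List Γ₀}
    {s s' : ℕ} (h : RunsInSpace M x s) (hs : s ≤ s') : RunsInSpace M x s' :=
  fun C hC => (h C hC).trans hs

namespace StackProg

open WordleInstance (encodeNumber Forced)

variable {B N : ℕ} {α : Type}

section Presentation

variable {WI : WordleInstance α} [Fintype α] (P : WI.Presentation)

theorem letters_length_le (L : List ℕ) : L.length ≤ (letters L).length := by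
  rw [← count_comma_letters]; exact List.count_le_length

theorem frame_length_bounds : (frame (letterNum P) P.dict).length + P.dict.length ≤ P.size ∧
    (frame (letterNum P) P.words).length + P.words.length ≤ P.size ∧
    (frame (letterNum P) P.dict).length + (frame (letterNum P) P.words).length ≤ P.size ∧
    5 ≤ P.size := by
  have h := size_eq P
  have h1 := length_wordsStr (letterNum P) P.dict
  have h2 := length_wordsStr (letterNum P) P.words
  have e1 : ∀ n : ℕ, (encodeNumber n).length = (Nat.bits n).length + 1 := by
    intro n; simp [encodeNumber]
  have := e1 WI.d
  have := e1 WI.g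
  have := e1 (Fintype.card α)
  omega

/-- Each letter of a listed word contributes a comma. Without any word the dimension appears only in
binary, and no such bound holds. -/
theorem dim_le_size (h : P.dict ≠ []) : WI.d ≤ P.size := by
  obtain ⟨u, l, hl⟩ := List.exists_cons_of_ne_nil h
  have h1 := frame_length_bounds P
  have h2 := letters_length_le (nums (letterNum P) u)
  rw [hl, frame_cons, length_nums] at *
  simp only [List.length_append, List.length_cons] at h1
  omega

variable [DecidableEq α]

theorem iter_game (hBN : B ≤ N) (hB : 4 * (WI.g * P.size) ≤ B) :
    ∃ b, (b = true ↔ WI.HasWinningStrategy) ∧ ∃ t ≤ iterBound P.size WI.g, Iter (Step B N) t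
      (conf (frame (letterNum P) P.dict) (frame (letterNum P) P.words) true false false false
        (2 * WI.g) [])
      (conf (frame (letterNum P) P.dict) (frame (letterNum P) P.words) true true b false
        (2 * WI.g) []) := by
  obtain ⟨h1, h2, h3, h4⟩ := frame_length_bounds P
  have hg := WI.g_pos
  have h5 : P.size ≤ WI.g * P.size := Nat.le_mul_of_pos_left _ hg
  have h6 : 5 * WI.g ≤ WI.g * P.size := by rw [mul_comm]; exact Nat.mul_le_mul_left _ h4
  rw [WordleInstance.hasWinningStrategy_iff_forced]
  -- With an empty dictionary `d` may exceed `B`, but the traversal fails in its first step and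
  -- never uses `d`.
  by_cases hD : P.dict = []
  · obtain ⟨n, hn⟩ := Nat.exists_eq_add_one.2 hg
    have hstep := runs_step_down (B := B) (N := N) (par := true) (F := []) (val := false)
      (n := 2 * n + 1) (dict := frame (letterNum P) P.dict)
      (wrds := frame (letterNum P) P.words) (letterNum P) P.dict rfl hBN
      (by simp only [List.append_nil]; omega) (by omega)
    rw [if_pos hD] at hstep
    rw [hn]
    refine ⟨false, ?_, 1, ?_, .single ⟨rfl, hstep⟩⟩
    · rw [Forced]
      simp [← P.mem_dict, hD]
    · rw [iterBound]; omega
  · have hd := dim_le_size P hD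
    have h7 : WI.g * ((frame (letterNum P) P.dict).length + (frame (letterNum P) P.words).length) ≤
        WI.g * P.size := Nat.mul_le_mul_left _ h3
    exact iter_rounds (letterNum_injective P) P.mem_dict P.mem_words (by omega) (by omega)
      (by omega) hBN WI.g [] (fun h => absurd h (by omega)) (by simpa using h7.trans (by omega))
      (by omega) false

theorem runs_main (hB : 4 * (WI.g * P.size) ≤ B)
    (hN : B + 2 * (P.size + 2) ^ (2 * WI.g) ≤ N) :
    ∃ b par up done, (b = true ↔ WI.HasWinningStrategy) ∧
      Runs B N main ⟨mem false false false false false,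
        Function.update (fun _ => []) .inp P.encode⟩
        ⟨mem false par up b done, fun _ => []⟩ := by
  obtain ⟨h1, h2, h3, h4⟩ := frame_length_bounds P
  have hg := WI.g_pos
  have h5 : P.size ≤ WI.g * P.size := Nat.le_mul_of_pos_left _ hg
  have h6 : 5 * WI.g ≤ WI.g * P.size := by rw [mul_comm]; exact Nat.mul_le_mul_left _ h4
  have hBN : B ≤ N := by omega
  obtain ⟨b, hb, t, ht, hit⟩ := iter_game P hBN hB
  have hT := iterBound_succ_le P.size WI.g
  refine ⟨b, true, true, true, hb, ?_⟩
  refine Runs.seq (runs_parse P (by omega) (by omega) hBN) ?_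
  refine Runs.seq (runs_load _ _) ?_
  -- One extra iteration finds the stack of frames empty and sets `done`. The remaining stacks are
  -- then cleared, as `decider_spec` requires.
  refine Runs.seq (t := conf (frame (letterNum P) P.dict) (frame (letterNum P) P.words) true true b
    true (2 * WI.g) []) ⟨t + 1, by omega, hit.trans (.single ⟨rfl, runs_step_done⟩), rfl⟩ ?_
  refine Runs.seq (runs_clear (by simp only [conf, cells]; omega)) ?_
  refine Runs.seq (runs_clear (by simp [conf, cells]; omega)) ?_
  refine (runs_clear (by simp [conf, cells]; omega)).congr ?_
  simp only [conf, mem]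
  congr 1
  funext j
  cases j <;> simp [cells]

end Presentation

/-- The machine that decides whether there is a winning strategy. -/
noncomputable def wordleDecider : Turing.TM2ComputableAux Γ' Bool :=
  decider main .inp (mem false false false false false) fun v => v.val

theorem wordleDecider_spec : ∃ c r : ℕ, ∀ (α : Type) [Fintype α] [DecidableEq α]
    (WI : WordleInstance α) (P : WI.Presentation),
    DecidesInTime wordleDecider P.encode WI.HasWinningStrategy
      (c * (4 * (WI.g * P.size) + 2 * (P.size + 2) ^ (2 * WI.g) + 1) ^ r + 1) ∧
    RunsInSpace wordleDecider P.encode (Fintype.card Stack * (4 * (WI.g * P.size)) + 1) := by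
  obtain ⟨c, r, hcr⟩ := stepBound_le main
  refine ⟨c, r, fun α _ _ WI P => ?_⟩
  obtain ⟨b, par, up, done, hb, hrun⟩ := runs_main P le_rfl le_rfl
  have h5 : P.size ≤ WI.g * P.size := Nat.le_mul_of_pos_left _ WI.g_pos
  have hx : P.encode.length ≤ 4 * (WI.g * P.size) := by
    change P.size ≤ _
    omega
  obtain ⟨h1, h2⟩ := decider_spec (out := fun v => v.val) hx hrun
  refine ⟨?_, h2⟩
  obtain ⟨b', hb', ⟨ho⟩⟩ := h1 _ hb
  exact ⟨b', hb', ⟨⟨ho.toEvalsTo, ho.steps_le_m.trans (Nat.succ_le_succ (hcr _))⟩⟩⟩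

/-- For `s ≥ 2` one has `g ≤ s ^ g` and `s + 2 ≤ s ^ 2`, so every summand of the loop bound is
absorbed into a power of `s` with exponent linear in `g`. -/
theorem time_le {c r s g : ℕ} (hs : 2 ≤ s) (hg : 1 ≤ g) :
    c * (4 * (g * s) + 2 * (s + 2) ^ (2 * g) + 1) ^ r + 1 ≤
      (c + 1) * s ^ (9 * r * g) := by
  have h1 : g ≤ s ^ g := (Nat.lt_pow_self (by omega : 1 < s)).le
  have h2 : s + 2 ≤ s ^ 2 := by nlinarith
  have hpow : ∀ {a b : ℕ}, a ≤ b → s ^ a ≤ s ^ b := fun h => Nat.pow_le_pow_right (by omega) h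
  have e1 : 4 * (g * s) ≤ s ^ (5 * g) := calc
    4 * (g * s) ≤ s ^ 2 * (s ^ g * s) := by gcongr; nlinarith
    _ = s ^ (g + 3) := by ring
    _ ≤ s ^ (g + 4 * g) := hpow (by omega)
    _ = s ^ (5 * g) := by congr 1; ring
  have e2 : 2 * (s + 2) ^ (2 * g) ≤ s ^ (5 * g) := calc
    2 * (s + 2) ^ (2 * g) ≤ s * (s ^ 2) ^ (2 * g) := by gcongr
    _ = s ^ (4 * g + 1) := by rw [← pow_mul, pow_succ]; ring_nf
    _ ≤ s ^ (5 * g) := hpow (by omega)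
  have e3 : 1 ≤ s ^ (5 * g) := Nat.one_le_pow _ _ (by omega)
  -- Three summands of size at most `s ^ (5 * g)`, and `3 ≤ s ^ 2`.
  have e4 : 4 * (g * s) + 2 * (s + 2) ^ (2 * g) + 1 ≤ s ^ (9 * g) := calc
    _ ≤ s ^ 2 * s ^ (5 * g) := by nlinarith
    _ = s ^ (2 + 5 * g) := by rw [pow_add]
    _ ≤ s ^ (9 * g) := hpow (by omega)
  have e5 : 1 ≤ s ^ (9 * r * g) := Nat.one_le_pow _ _ (by omega)
  calc _ ≤ c * (s ^ (9 * g)) ^ r + s ^ (9 * r * g) := by gcongr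
    _ = (c + 1) * s ^ (9 * r * g) := by rw [← pow_mul]; ring_nf

theorem wordleDecider_bounds : ∃ c : ℕ, ∀ (α : Type) [Fintype α] [DecidableEq α]
    (WI : WordleInstance α) (P : WI.Presentation),
    DecidesInTime wordleDecider P.encode WI.HasWinningStrategy (c * P.size ^ (c * WI.g)) ∧
    RunsInSpace wordleDecider P.encode (c * (WI.g * P.size)) := by
  obtain ⟨c, r, h⟩ := wordleDecider_spec
  -- A single constant that dominates the coefficient `c + 1`, the exponent factor `9 * r` and the
  -- space factor.
  refine ⟨c + 1 + 9 * r + (Fintype.card Stack * 4 + 1), fun α _ _ WI P => ?_⟩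
  obtain ⟨h1, h2⟩ := h α WI P
  have h5 := (frame_length_bounds P).2.2.2
  have h6 : 1 ≤ WI.g * P.size := Nat.mul_pos WI.g_pos (by omega)
  refine ⟨h1.mono ((time_le (by omega) WI.g_pos).trans ?_), h2.mono ?_⟩
  · exact Nat.mul_le_mul (by omega) (Nat.pow_le_pow_right (by omega)
      (Nat.mul_le_mul_right _ (by omega)))
  · calc _ ≤ (Fintype.card Stack * 4 + 1) * (WI.g * P.size) := by
          rw [add_mul, one_mul, mul_assoc]; omega
      _ ≤ _ := Nat.mul_le_mul_right _ (by omega)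

end StackProg

theorem theorem2 :
    ∃ M : Turing.TM2ComputableAux Computability.Γ' Bool,
      (∀ k, Finite (M.tm.Γ k)) ∧
      (∃ c : ℕ, ∀ (α : Type) [Fintype α] [DecidableEq α] (WI : WordleInstance α)
        (P : WI.Presentation),
        DecidesInTime M P.encode WI.HasWinningStrategy (c * P.size ^ (c * WI.g)) ∧
        RunsInSpace M P.encode (c * (WI.g * P.size))) ∧
      (∀ g : ℕ, ∃ p : Polynomial ℕ, ∀ (α : Type) [Fintype α] [DecidableEq α]
        (WI : WordleInstance α) (P : WI.Presentation), WI.g = g →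
        DecidesInTime M P.encode WI.HasWinningStrategy (p.eval P.size)) := by
  refine ⟨StackProg.wordleDecider, ?_, StackProg.wordleDecider_bounds, fun g => ?_⟩
  · rintro (_ | k)
    · exact inferInstanceAs (Finite Bool)
    · exact inferInstanceAs (Finite Γ')
  · obtain ⟨c, hc⟩ := StackProg.wordleDecider_bounds
    refine ⟨Polynomial.C c * Polynomial.X ^ (c * g), fun α _ _ WI P hg => ?_⟩
    subst hg
    simpa using (hc α WI P).1
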